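/- All graphs are directed, at most countable, and simple (no loops; edges are ordered pairs of vertices, so no multiple edges), and each vertex has only finitely many outgoing edges. A graph homomorphism is a map of vertices sending edges $(v,w)$ to edges; it induces a map on edges. Let $(G_n)_{n\in\mathbb N}$ be a sequence of finite such graphs with injective graph homomorphisms $\varphi_n:G_n\to G_{n+1}$, and let $G$, with homomorphisms $\psi_n:G_n\to G$, be its direct limit in the category of these graphs and homomorphisms: $\psi_{n+1}\circ\varphi_n=\psi_n$ for all $n$, and for every graph $B$ of the category with homomorphisms $\vartheta_n:G_n\to B$ satisfying $\vartheta_{n+1}\circ\varphi_n=\vartheta_n$ there is a unique homomorphism $\alpha:G\to B$ with $\alpha\circ\psi_n=\vartheta_n$ for all $n$. Assume that the number of outgoing edges of the vertices of $G$ is uniformly bounded. Let $(a_j)$ and $(c_j)$ be real numbers indexed by the edges $j\in E(G)$ with $0<m\le a_j\le M$ and $m\le c_j\le M$ for all $j$; the edges of $G_n$ carry the values of their images under $\psi_n$. For $H\in\{G,G_0,G_1,\dots\}$ let $\mathbb B_{ij}=1$ if the head of the edge $j$ of $H$ is the tail of the edge $i$ of $H$, and $\mathbb B_{ij}=0$ otherwise;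 put $C=\operatorname{diag}(c_j)$, $\mathbb B_C=C^{-1}\mathbb B C$. On $L^1([0,1],\ell^1(E(H)))$ consider the operator $$A_H f=\Big(a_j\tfrac{d}{dx}f_j\Big)_{j\in E(H)},\qquad D(A_H)=\{f\in W^{1,1}([0,1],\ell^1(E(H))) : f(1)=\mathbb B_C f(0)\}.$$ (For $a_j=1$ this is the operator $\operatorname{diag}(d/dx)$, for $a_j=c_j$ it is the operator of the transport equation $\partial_t w_j=c_j\partial_x w_j$. For finite $H$ the space is $L^1([0,1],\mathbb C^{|E(H)|})$, with the $1$-norm on $\mathbb C^{|E(H)|}$.) Write $X=L^1([0,1],\ell^1(E(G)))$ and $X_n=L^1([0,1],\mathbb C^{|E(G_n)|})$. Let $E_n:X_n\to X$ be the extension by zero along the edge map of $\psi_n$ and $P_n:X\to X_n$ the cut-off $(P_nf)_e=f_{\psi_n(e)}$. Then $A_G$ generates a $C_0$-semigroup $(T(t))_{t\ge0}$ on $X$, each $A_{G_n}$ generates a $C_0$-semigroup $(T_n(t))_{t\ge0}$ on $X_n$, and for every $x\in X$ one has $$\lim_{n\to\infty}\|E_nT_n(t)P_nx-T(t)x\|=0$$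 uniformly for $t$ in bounded subintervals of $[0,\infty)$. -/

import Mathlib

open MeasureTheory Filter Topology CategoryTheory
open scoped NNReal ENNReal

universe u

/-! ### Simple locally finite directed graphs and direct limits -/

/-- Objects: at most countable directed graphs (the edge set is a set of ordered pairs of vertices,
so there are no multiple edges) without loops, in which every vertex has only finitely many
outgoing edges. -/
structure SimpLocFinG : Type (u + 1) where
  V : Type u
  countable_V : Countable V
  graph : Digraph V
  loopless : ∀ v, ¬ graph.Adj v v
  locallyFinite : ∀ v, {w | graph.Adj v w}.Finite

namespace SimpLocFinG

/-- Graph homomorphisms: maps of vertices that send (directed) edges to edges. -/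
@[ext]
structure Hom (G H : SimpLocFinG.{u}) where
  toFun : G.V → H.V
  map_adj : ∀ v w, G.graph.Adj v w → H.graph.Adj (toFun v) (toFun w)

instance : Category SimpLocFinG.{u} where
  Hom := Hom
  id G := ⟨id, fun _ _ h => h⟩
  comp f g := ⟨g.toFun ∘ f.toFun, fun _ _ h => g.map_adj _ _ (f.map_adj _ _ h)⟩

/-- The map on vertices underlying an arrow. -/
def onV {G H : SimpLocFinG.{u}} (φ : G ⟶ H) : G.V → H.V := Hom.toFun φ

/-- The directed edges `(tail, head)` of `G`. -/
def Edge (G : SimpLocFinG.{u}) : Type u := {p : G.V × G.V // G.graph.Adj p.1 p.2}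

def Edge.tail {G : SimpLocFinG.{u}} (e : G.Edge) : G.V := e.1.1

def Edge.head {G : SimpLocFinG.{u}} (e : G.Edge) : G.V := e.1.2

instance (G : SimpLocFinG.{u}) [Finite G.V] : Finite G.Edge :=
  inferInstanceAs (Finite {p : G.V × G.V // G.graph.Adj p.1 p.2})

/-- The map on edges induced by a graph homomorphism. -/
def onEdge {G H : SimpLocFinG.{u}} (φ : G ⟶ H) (e : G.Edge) : H.Edge :=
  ⟨(onV φ e.tail, onV φ e.head), Hom.map_adj φ _ _ e.2⟩

/-- The number of outgoing edges is bounded uniformly over all vertices. -/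
def UniformlyLocallyFinite (G : SimpLocFinG.{u}) : Prop :=
  ∃ N : ℕ, ∀ v, {w | G.graph.Adj v w}.encard ≤ N

open Classical in
/-- The transposed adjacency matrix `𝔹` of the line graph: `𝔹 i j = 1` if the head of `e_j` is the
tail of `e_i`, and `0` otherwise. -/
noncomputable def lineAdj (G : SimpLocFinG.{u}) : Matrix G.Edge G.Edge ℂ :=
  fun i j => if j.head = i.tail then 1 else 0

/-- The matrix `𝔹_C = C⁻¹ 𝔹 C` with `C = diag (c_j)`. -/
noncomputable def lineAdjC (G : SimpLocFinG.{u}) (c : G.Edge → ℝ) : Matrix G.Edge G.Edge ℂ :=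
  fun i j => (c i : ℂ)⁻¹ * G.lineAdj i j * (c j : ℂ)

end SimpLocFinG

/-- `L`, with the arrows `ψ n : A n ⟶ L`, is the direct limit of the sequence
`A 0 ⟶ A 1 ⟶ A 2 ⟶ ⋯` with arrows `φ n`. -/
def IsDirectLimit {C : Type*} [Category C] {A : ℕ → C} (φ : ∀ n, A n ⟶ A (n + 1))
    {L : C} (ψ : ∀ n, A n ⟶ L) : Prop :=
  (∀ n, φ n ≫ ψ (n + 1) = ψ n) ∧
    ∀ (B : C) (θ : ∀ n, A n ⟶ B), (∀ n, φ n ≫ θ (n + 1) = θ n) →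
      ∃! α : L ⟶ B, ∀ n, ψ n ≫ α = θ n

/-! ### The phase spaces -/

/-- `ℓ¹(J)`; for `J` with `m` elements this is `ℂ ^ m` with the `1`-norm. -/
abbrev EllOne (J : Type*) : Type _ := lp (fun _ : J => ℂ) 1

/-- Lebesgue measure on `[0, 1]`. -/
noncomputable abbrev unitMeasure : Measure ℝ := volume.restrict (Set.Icc (0 : ℝ) 1)

/-- The Banach space `L¹([0, 1], ℓ¹(J))`. -/
abbrev PhaseSpace (J : Type*) : Type _ := Lp (EllOne J) 1 unitMeasure

/-- The coordinate functional `x ↦ x j` on `ℓ¹(J)`. -/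
noncomputable def EllOne.coord {J : Type*} (j : J) : EllOne J →L[ℂ] ℂ :=
  LinearMap.mkContinuous
    { toFun := fun x => x j
      map_add' := fun _ _ => rfl
      map_smul' := fun _ _ => rfl } 1
    (fun x => (lp.norm_apply_le_norm one_ne_zero x j).trans_eq (one_mul _).symm)

theorem EllOne.coord_apply {J : Type*} (j : J) (x : EllOne J) : EllOne.coord j x = x j := rfl

open Classical in
/-- For an injective map `ι : J → K` with `J` finite, the zero extension `ℓ¹(J) → ℓ¹(K)`,
which places the coordinate `j` at position `ι j`. -/
noncomputable def EllOne.extendZero {J K : Type*} [Finite J] (ι : J → K) :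
    EllOne J →L[ℂ] EllOne K :=
  letI := Fintype.ofFinite J
  ∑ j : J, (lp.singleContinuousLinearMap ℂ (fun _ : K => ℂ) 1 (ι j)) ∘L EllOne.coord j

open Classical in
/-- For a map `ι : J → K` with `J` finite, the cut-off `ℓ¹(K) → ℓ¹(J)`, `x ↦ (x (ι j))_j`. -/
noncomputable def EllOne.cutOff {J K : Type*} [Finite J] (ι : J → K) :
    EllOne K →L[ℂ] EllOne J :=
  letI := Fintype.ofFinite J
  ∑ j : J, (lp.singleContinuousLinearMap ℂ (fun _ : J => ℂ) 1 j) ∘L EllOne.coord (ι j)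

theorem EllOne.extendZero_apply {J K : Type*} [Finite J] {ι : J → K} (hι : ι.Injective)
    (x : EllOne J) (j : J) : EllOne.extendZero ι x (ι j) = x j := by
  classical
  let _ := Fintype.ofFinite J
  simp only [EllOne.extendZero, sum_apply, ContinuousLinearMap.comp_apply,
    lp.singleContinuousLinearMap_apply, lp.coeFn_sum, Finset.sum_apply, lp.single_apply,
    Pi.single_apply, hι.eq_iff]
  rw [Finset.sum_eq_single j] <;> simp +contextual [EllOne.coord_apply, eq_comm]

theorem EllOne.extendZero_apply_of_notMem {J K : Type*} [Finite J] {ι : J → K}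
    (x : EllOne J) (k : K) (hk : k ∉ Set.range ι) : EllOne.extendZero ι x k = 0 := by
  classical
  let _ := Fintype.ofFinite J
  simp only [EllOne.extendZero, sum_apply, ContinuousLinearMap.comp_apply,
    lp.singleContinuousLinearMap_apply, lp.coeFn_sum, Finset.sum_apply, lp.single_apply,
    Pi.single_apply]
  exact Finset.sum_eq_zero fun j _ => if_neg fun h => hk ⟨j, h.symm⟩

theorem EllOne.cutOff_apply {J K : Type*} [Finite J] {ι : J → K}
    (x : EllOne K) (j : J) : EllOne.cutOff ι x j = x (ι j) := by
  classical
  let _ := Fintype.ofFinite J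
  simp only [EllOne.cutOff, sum_apply, ContinuousLinearMap.comp_apply,
    lp.singleContinuousLinearMap_apply, lp.coeFn_sum, Finset.sum_apply, lp.single_apply,
    Pi.single_apply]
  rw [Finset.sum_eq_single j] <;> simp +contextual [EllOne.coord_apply, eq_comm]

/-- The operator `E : L¹([0,1], ℓ¹(J)) → L¹([0,1], ℓ¹(K))` of extension by zero along `ι`. -/
noncomputable def extensionOp {J K : Type*} [Finite J] (ι : J → K) :
    PhaseSpace J →L[ℂ] PhaseSpace K :=
  (EllOne.extendZero ι).compLpL 1 unitMeasure

/-- The cut-off operator `P : L¹([0,1], ℓ¹(K)) → L¹([0,1], ℓ¹(J))` along `ι`. -/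
noncomputable def cutOffOp {J K : Type*} [Finite J] (ι : J → K) :
    PhaseSpace K →L[ℂ] PhaseSpace J :=
  (EllOne.cutOff ι).compLpL 1 unitMeasure

/-! ### Semigroups and generators -/

/-- `C₀`-semigroups of bounded linear operators. -/
structure IsC0Semigroup {X : Type*} [NormedAddCommGroup X] [NormedSpace ℂ X]
    (T : ℝ≥0 → X →L[ℂ] X) : Prop where
  map_zero : T 0 = ContinuousLinearMap.id ℂ X
  map_add : ∀ t s, T (t + s) = T t ∘L T s
  tendsto_zero : ∀ f, Tendsto (fun t => T t f) (𝓝[>] 0) (𝓝 f)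

/-- The (graph of the) generator of `T`: `f` is in its domain and is mapped to `g`. -/
def GeneratorGraph {X : Type*} [NormedAddCommGroup X] [NormedSpace ℂ X]
    (T : ℝ≥0 → X →L[ℂ] X) (f g : X) : Prop :=
  Tendsto (fun t : ℝ≥0 => ((t : ℝ) : ℂ)⁻¹ • (T t f - f)) (𝓝[>] 0) (𝓝 g)

/-- `T` is a `C₀`-semigroup whose generator is the operator with graph `A`. -/
def IsSemigroupGeneratedBy {X : Type*} [NormedAddCommGroup X] [NormedSpace ℂ X]
    (T : ℝ≥0 → X →L[ℂ] X) (A : X → X → Prop) : Prop :=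
  IsC0Semigroup T ∧ ∀ f g, GeneratorGraph T f g ↔ A f g

/-! ### The transport operator -/

/-- `f ∈ W^{1,1}([0,1], ℓ¹(J))` with derivative `g` and absolutely continuous representative `u`
on `[0, 1]`. -/
def IsW11Rep {J : Type*} (f g : PhaseSpace J) (u : ℝ → EllOne J) : Prop :=
  (f =ᵐ[unitMeasure] u) ∧ ∀ s ∈ Set.Icc (0 : ℝ) 1, u s = u 0 + ∫ τ in (0 : ℝ)..s, g τ

/-- The graph of the transport operator: `f ∈ W^{1,1}([0,1], ℓ¹)`, `f(1) = 𝔹_C f(0)` and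
`h = diag (a_j d/dx) f`. -/
def SimpLocFinG.TransportGraph (G : SimpLocFinG.{u}) (a c : G.Edge → ℝ)
    (f h : PhaseSpace G.Edge) : Prop :=
  ∃ (g : PhaseSpace G.Edge) (u : ℝ → EllOne G.Edge), IsW11Rep f g u ∧
    (∀ i, HasSum (fun j => G.lineAdjC c i j * u 0 j) (u 1 i)) ∧
    ∀ᵐ s ∂unitMeasure, ∀ j, h s j = (a j : ℂ) * g s j

/-! Write `b` for the diagonal operator with entries `1 / a j`. The transport operator is then `b⁻¹
d/dx` on `L¹([0, 1], Y)`, `Y = ℓ¹`, with boundary condition `f(1) = B f(0)`, where `B` is given by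
the matrix `𝔹_C`. Its columns have `ℓ¹`-norm at most `N M / m` when out-degrees are at most `N`, so
`B` is bounded.

Choose `ν ≥ 0` with `‖B‖ ≤ exp ν`. In the equivalent norm `∫ exp (-ν x) ‖b (f x)‖ dx` the operator
minus `ν M` is dissipative: in the energy estimate the boundary terms at `0` and `1` have a
favourable sign (`weighted_integral_le`). Together with solvability of the resolvent equation this
yields the Hille–Yosida estimates with `ω = ν M` and constant `exp ν * M / m`
(`exists_hilleYosida`), and hence a semigroup.

The universal property of the direct limit makes every `ψ n` injective and every edge of `G` the
image of an edge of `G_n` for all large `n`. Adjacency of edges depends only on coincidence of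
vertices, so the boundary matrix of `G_n` is the compression `p B e` of `B`, with `e` extension by
zero and `p` cut-off. The constants above therefore serve all `n` at once. The cut-off of a
resolvent solution on `G` misses the boundary condition on `G_n` by a vector tending to `0`, which a
linear function of `x` corrects; so the resolvents converge strongly
(`tendsto_resolvent_of_compression`), and Trotter–Kato (`tendstoUniformlyOn_of_resolvent`) transfers
this to the semigroups. Hille–Yosida and Trotter–Kato are both proved through Yosida approximations.
-/

/-! ### Exponentials of bounded operators and the Duhamel estimate. -/

section OperatorExponential

variable {X : Type*} [NormedAddCommGroup X] [NormedSpace ℂ X]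

/-- The one-parameter group `t ↦ exp (t Z)` generated by a bounded operator `Z`. -/
noncomputable def opExp (Z : X →L[ℂ] X) (t : ℝ) : X →L[ℂ] X := NormedSpace.exp ((t : ℂ) • Z)

theorem opExp_zero (Z : X →L[ℂ] X) : opExp Z 0 = 1 := by simp [opExp]

theorem Commute.opExp_right {W Z : X →L[ℂ] X} (h : Commute W Z) (t : ℝ) :
    Commute W (opExp Z t) :=
  (h.smul_right (t : ℂ)).exp_right

variable [CompleteSpace X]

theorem opExp_add (Z : X →L[ℂ] X) (s t : ℝ) : opExp Z (s + t) = opExp Z s * opExp Z t := by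
  let _ : NormedAlgebra ℚ (X →L[ℂ] X) := NormedAlgebra.restrictScalars ℚ ℂ _
  rw [opExp, opExp, opExp, ← NormedSpace.exp_add_of_commute, ← add_smul, Complex.ofReal_add]
  exact ((Commute.refl Z).smul_left _).smul_right _

/-- Time is real while the operators are complex linear. Restricting scalars lets the product rule
for evaluation along a real curve apply. -/
theorem hasDerivAt_opExp (Z : X →L[ℂ] X) (t : ℝ) :
    HasDerivAt (fun s : ℝ => (opExp Z s).restrictScalars ℝ)
      ((opExp Z t * Z).restrictScalars ℝ) t := by
  have h := HasDerivAt.scomp t (hasDerivAt_exp_smul_const (𝕂 := ℂ) Z (t : ℂ))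
    Complex.ofRealCLM.hasDerivAt
  have h' := (ContinuousLinearMap.restrictScalarsL ℂ X X ℝ ℝ).hasFDerivAt.comp_hasDerivAt t h
  simpa [Function.comp_def, opExp] using h'

theorem hasDerivAt_opExp_apply (Z : X →L[ℂ] X) (x : X) (t : ℝ) :
    HasDerivAt (fun s : ℝ => opExp Z s x) (opExp Z t (Z x)) t := by
  simpa using (hasDerivAt_opExp Z t).clm_apply (hasDerivAt_const t x)

theorem continuous_opExp_apply (Z : X →L[ℂ] X) (x : X) : Continuous fun s : ℝ => opExp Z s x :=
  continuous_iff_continuousAt.2 fun t => (hasDerivAt_opExp_apply Z x t).continuousAt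

/-- A curve `v` that solves `v' = Z v` up to an error stays close to `t ↦ exp (t Z) v(0)`. -/
theorem norm_sub_opExp_le {Z : X →L[ℂ] X} {v v' : ℝ → X} {t D : ℝ} (ht : 0 ≤ t)
    (hv : ContinuousOn v (Set.Icc 0 t))
    (hv' : ∀ s ∈ Set.Ico 0 t, HasDerivWithinAt v (v' s) (Set.Ici s) s)
    (hD : ∀ s ∈ Set.Ico 0 t, ‖opExp Z (t - s) (v' s - Z (v s))‖ ≤ D) :
    ‖v t - opExp Z t (v 0)‖ ≤ D * t := by
  have hd : ∀ s : ℝ, HasDerivAt (fun s : ℝ => (opExp Z (t - s)).restrictScalars ℝ)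
      (-(opExp Z (t - s) * Z).restrictScalars ℝ) s := fun s => by
    have h := HasDerivAt.scomp s (hasDerivAt_opExp Z (t - s)) ((hasDerivAt_id s).const_sub t)
    rw [neg_one_smul] at h
    exact h
  -- Duhamel's trick: `s ↦ exp ((t - s) Z) (v s)` runs from `exp (t Z) (v 0)` to `v t`, and its
  -- right derivative is `exp ((t - s) Z) (v' s - Z (v s))`. Right derivatives suffice, which is all
  -- that orbits of a semigroup provide at first.
  have hc : ContinuousOn (fun s : ℝ => (opExp Z (t - s)).restrictScalars ℝ (v s))
      (Set.Icc 0 t) := fun s hs =>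
    ((hd s).continuousAt.continuousWithinAt).clm_apply (hv s hs)
  have h := norm_image_sub_le_of_norm_deriv_right_le_segment (C := D) hc
    (fun s hs => ((hd s).hasDerivWithinAt).clm_apply (hv' s hs)) (fun s hs => ?_) t ⟨ht, le_rfl⟩
  · simpa [opExp_zero] using h
  · refine le_trans (le_of_eq ?_) (hD s hs)
    congr 1
    simp [sub_eq_neg_add]

end OperatorExponential

/-! ### Resolvents and Yosida approximations. -/

section Yosida

variable {X : Type*} [NormedAddCommGroup X] [NormedSpace ℂ X]

/-- The operators `R l`, `l > ω`, are the resolvents of the densely defined operator with graph `A`,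
and they satisfy the Hille–Yosida estimates with constants `ω` and `C`. -/
structure HilleYosida (A : X → X → Prop) (R : ℝ → X →L[ℂ] X) (ω C : ℝ) : Prop where
  omega_nonneg : 0 ≤ ω
  graph_iff : ∀ l, ω < l → ∀ f g, A f g ↔ R l ((l : ℂ) • f - g) = f
  norm_pow_le : ∀ l, ω < l → ∀ k : ℕ, ‖R l ^ k‖ ≤ C * (l - ω)⁻¹ ^ k
  dense : Dense {f | ∃ g, A f g}

/-- The Yosida approximation `l² R(l) - l` of an operator with resolvents `R`. -/
noncomputable def yosida (R : ℝ → X →L[ℂ] X) (l : ℝ) : X →L[ℂ] X :=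
  (l : ℂ) ^ 2 • R l - (l : ℂ) • 1

namespace HilleYosida

variable {A : X → X → Prop} {R : ℝ → X →L[ℂ] X} {ω C : ℝ}

theorem const_nonneg (H : HilleYosida A R ω C) : 0 ≤ C := by
  simpa using (norm_nonneg _).trans (H.norm_pow_le (ω + 1) (by linarith) 0)

theorem norm_resolvent_le (H : HilleYosida A R ω C) {l : ℝ} (hl : ω < l) :
    ‖R l‖ ≤ C * (l - ω)⁻¹ := by
  simpa using H.norm_pow_le l hl 1

theorem graph_resolvent (H : HilleYosida A R ω C) {l : ℝ} (hl : ω < l) (h : X) :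
    A (R l h) ((l : ℂ) • R l h - h) := by
  rw [H.graph_iff l hl]; simp

theorem resolvent_mul (H : HilleYosida A R ω C) {l k : ℝ} (hl : ω < l) (hk : ω < k) :
    ((l : ℂ) - k) • (R l * R k) = R k - R l := by
  ext h
  have h1 := (H.graph_iff l hl _ _).1 (H.graph_resolvent hk h)
  simp only [map_sub, map_smul] at h1
  simp only [_root_.smul_apply, sub_apply, mul_apply_eq_comp, sub_smul]
  rw [eq_sub_iff_add_eq]
  nth_rw 3 [← h1]
  abel

theorem commute_resolvent (H : HilleYosida A R ω C) {l k : ℝ} (hl : ω < l) (hk : ω < k) :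
    Commute (R l) (R k) := by
  rcases eq_or_ne l k with rfl | hne
  · exact Commute.refl _
  · have h0 : (l : ℂ) - k ≠ 0 := sub_ne_zero.2 (by exact_mod_cast hne)
    have h1 := H.resolvent_mul hl hk
    have h2 := H.resolvent_mul hk hl
    rw [← neg_sub (l : ℂ) k, ← neg_sub (R k) (R l), neg_smul, neg_inj] at h2
    exact smul_right_injective _ h0 (h1.trans h2.symm)

theorem commute_yosida (H : HilleYosida A R ω C) {l k : ℝ} (hl : ω < l) (hk : ω < k) :
    Commute (R k) (yosida R l) :=
  ((H.commute_resolvent hk hl).smul_right _).sub_right ((Commute.one_right _).smul_right _)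

/-- On the domain the Yosida approximation is `l R(l) A`; as `l R(l)` tends strongly to the
identity, it approximates `A` there. -/
theorem yosida_apply (H : HilleYosida A R ω C) {l : ℝ} (hl : ω < l) {x y : X} (hxy : A x y) :
    yosida R l x = (l : ℂ) • R l y := by
  have h := (H.graph_iff l hl x y).1 hxy
  rw [map_sub, map_smul, sub_eq_iff_eq_add] at h
  simp only [yosida, sub_apply, _root_.smul_apply, one_apply_eq_self, pow_two,
    mul_smul, h, smul_add]
  abel

theorem smul_resolvent_sub (H : HilleYosida A R ω C) {l : ℝ} (hl : ω < l) {x y : X}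
    (hxy : A x y) : (l : ℂ) • R l x - x = R l y := by
  have h := (H.graph_iff l hl x y).1 hxy
  rw [map_sub, map_smul] at h
  nth_rw 2 [← h]
  abel

variable [CompleteSpace X]

/-- Summing the exponential series termwise costs the constant `C` only once because the hypothesis
bounds every power of `R l`, not just `R l` itself. -/
theorem norm_opExp_resolvent_le (H : HilleYosida A R ω C) {l : ℝ} (hl : ω < l) {r : ℝ}
    (hr : 0 ≤ r) : ‖opExp (R l) r‖ ≤ C * Real.exp (r * (l - ω)⁻¹) := by
  have h1 : HasSum (fun n : ℕ => ((n.factorial : ℂ)⁻¹) • ((r : ℂ) • R l) ^ n) (opExp (R l) r) :=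
    NormedSpace.exp_series_hasSum_exp' _
  have h2 := (NormedSpace.exp_series_hasSum_exp' (𝕂 := ℝ) (r * (l - ω)⁻¹)).mul_left C
  rw [← Real.exp_eq_exp_ℝ] at h2
  refine h1.norm_le_of_bounded h2 fun n => ?_
  rw [smul_pow, norm_smul, norm_smul, norm_inv, norm_pow, Complex.norm_natCast, Complex.norm_real,
    Real.norm_of_nonneg hr, smul_eq_mul, mul_pow]
  calc (n.factorial : ℝ)⁻¹ * (r ^ n * ‖R l ^ n‖)
      ≤ (n.factorial : ℝ)⁻¹ * (r ^ n * (C * (l - ω)⁻¹ ^ n)) := by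
        gcongr; exact H.norm_pow_le l hl n
    _ = _ := by ring

theorem opExp_yosida (R : ℝ → X →L[ℂ] X) (l t : ℝ) :
    opExp (yosida R l) t = Complex.exp (-(t * l)) • opExp (R l) (t * l ^ 2) := by
  let _ : NormedAlgebra ℚ (X →L[ℂ] X) := NormedAlgebra.restrictScalars ℚ ℂ _
  have h : (t : ℂ) • yosida R l
      = algebraMap ℂ (X →L[ℂ] X) (-(t * l)) + ((t * l ^ 2 : ℝ) : ℂ) • R l := by
    rw [yosida, Algebra.algebraMap_eq_smul_one, smul_sub, smul_smul, smul_smul, neg_smul]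
    push_cast
    abel
  rw [opExp, h, NormedSpace.exp_add_of_commute (Algebra.commutes _ _),
    ← NormedSpace.algebraMap_exp_comm, ← Complex.exp_eq_exp_ℂ, ← Algebra.smul_def, opExp]

theorem norm_opExp_yosida_le (H : HilleYosida A R ω C) {l : ℝ} (hl : 2 * ω < l) {t : ℝ}
    (ht : 0 ≤ t) : ‖opExp (yosida R l) t‖ ≤ C * Real.exp (2 * ω * t) := by
  have hω := H.omega_nonneg
  have hl' : ω < l := by linarith
  have hd : 0 < l - ω := by linarith
  rw [opExp_yosida, norm_smul]
  have h1 : ‖Complex.exp (-(t * l))‖ = Real.exp (-(t * l)) := by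
    rw [Complex.norm_exp]; simp
  rw [h1]
  calc Real.exp (-(t * l)) * ‖opExp (R l) (t * l ^ 2)‖
      ≤ Real.exp (-(t * l)) * (C * Real.exp (t * l ^ 2 * (l - ω)⁻¹)) := by
        gcongr; exact H.norm_opExp_resolvent_le hl' (by positivity)
    _ = C * Real.exp (-(t * l) + t * l ^ 2 * (l - ω)⁻¹) := by rw [Real.exp_add]; ring
    _ ≤ C * Real.exp (2 * ω * t) := by
        have := H.const_nonneg
        gcongr
        -- The growth rate is `ω l / (l - ω)`, which is at most `2 ω` once `l ≥ 2 ω`; hence the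
        -- threshold `2 * ω` here and below.
        have : -(t * l) + t * l ^ 2 * (l - ω)⁻¹ = t * (ω * (l * (l - ω)⁻¹)) := by
          field_simp; ring
        rw [this]
        have h2 : l * (l - ω)⁻¹ ≤ 2 := by
          rw [← div_eq_mul_inv, div_le_iff₀ hd]; linarith
        calc t * (ω * (l * (l - ω)⁻¹)) ≤ t * (ω * 2) := by gcongr
          _ = _ := by ring

/-- Duhamel's estimate for two commuting generators: the error along the orbit is `exp (s A_l) (A_l
x - A_k x)`. Each of the two exponentials contributes one factor `C * exp (2 ω t)`. -/
theorem norm_opExp_yosida_sub_le (H : HilleYosida A R ω C) {l k : ℝ} (hl : 2 * ω < l)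
    (hk : 2 * ω < k) {s t : ℝ} (hs : 0 ≤ s) (hst : s ≤ t) (x : X) :
    ‖opExp (yosida R l) s x - opExp (yosida R k) s x‖
      ≤ t * (C * Real.exp (2 * ω * t)) ^ 2 * ‖yosida R l x - yosida R k x‖ := by
  have hω := H.omega_nonneg
  have hC := H.const_nonneg
  have ht : 0 ≤ t := hs.trans hst
  have hcomm : Commute (yosida R k) (yosida R l) := by
    unfold yosida
    exact (((H.commute_yosida (l := l) (k := k) (by linarith) (by linarith)).smul_left _).sub_left
      ((Commute.one_left _).smul_left _))
  have hb : ∀ {m : ℝ}, 2 * ω < m → ∀ r, 0 ≤ r → r ≤ t →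
      ‖opExp (yosida R m) r‖ ≤ C * Real.exp (2 * ω * t) := fun hm r hr hrt =>
    (H.norm_opExp_yosida_le hm hr).trans (by gcongr)
  have h := norm_sub_opExp_le (Z := yosida R k) (v := fun r => opExp (yosida R l) r x)
    (v' := fun r => opExp (yosida R l) r (yosida R l x))
    (D := (C * Real.exp (2 * ω * t)) ^ 2 * ‖yosida R l x - yosida R k x‖) hs
    (continuous_opExp_apply _ _).continuousOn
    (fun r _ => (hasDerivAt_opExp_apply _ _ _).hasDerivWithinAt) (fun r hr => ?_)
  · simp only [opExp_zero, one_apply_eq_self] at h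
    refine h.trans ?_
    rw [mul_comm, ← mul_assoc]
    gcongr
  · have h1 : yosida R k (opExp (yosida R l) r x) = opExp (yosida R l) r (yosida R k x) :=
      congrArg (fun L : X →L[ℂ] X => L x) (hcomm.opExp_right r).eq
    rw [h1, ← map_sub, pow_two, mul_assoc]
    refine (ContinuousLinearMap.le_opNorm _ _).trans ?_
    gcongr
    · exact hb hk _ (by linarith [hr.2]) (by linarith [hr.1])
    · refine (ContinuousLinearMap.le_opNorm _ _).trans ?_
      gcongr
      exact hb hl _ hr.1 (by linarith [hr.2])

end HilleYosida

end Yosida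

/-! ### Extending strong convergence from a dense set. -/

section StrongConvergence

variable {X Z ι τ : Type*} [NormedAddCommGroup X] [NormedSpace ℂ X] [NormedAddCommGroup Z]
  [NormedSpace ℂ Z]

/-- Uniform convergence of uniformly bounded operators extends from a dense set. -/
theorem tendstoUniformlyOn_of_dense {F : Filter ι} {s : Set τ} {L : ι → τ → X →L[ℂ] Z}
    {L₀ : τ → X →L[ℂ] Z} {K : ℝ} (hL : ∀ᶠ i in F, ∀ t ∈ s, ‖L i t‖ ≤ K)
    (hL₀ : ∀ t ∈ s, ‖L₀ t‖ ≤ K) {S : Set X} (hS : Dense S)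
    (h : ∀ x ∈ S, TendstoUniformlyOn (fun i t => L i t x) (fun t => L₀ t x) F s) (x : X) :
    TendstoUniformlyOn (fun i t => L i t x) (fun t => L₀ t x) F s := by
  rw [Metric.tendstoUniformlyOn_iff]
  intro ε hε
  rcases s.eq_empty_or_nonempty with rfl | ⟨t₁, ht₁⟩
  · simp
  have hK : 0 ≤ K := (norm_nonneg _).trans (hL₀ t₁ ht₁)
  obtain ⟨y, hy, hxy⟩ := Metric.dense_iff.1 hS x (ε / (3 * (K + 1))) (by positivity)
  rw [Metric.mem_ball, dist_eq_norm, lt_div_iff₀ (by positivity)] at hy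
  have hsmall : K * ‖y - x‖ ≤ ε / 3 := by nlinarith [norm_nonneg (y - x)]
  filter_upwards [hL, (Metric.tendstoUniformlyOn_iff.1 (h y hxy)) (ε / 3) (by positivity)]
    with i hi hi' t ht
  have h1 : dist (L₀ t x) (L₀ t y) ≤ ε / 3 := by
    rw [dist_comm, dist_eq_norm, ← map_sub]
    refine ((L₀ t).le_opNorm _).trans (le_trans ?_ hsmall)
    gcongr; exact hL₀ t ht
  have h2 : dist (L i t y) (L i t x) ≤ ε / 3 := by
    rw [dist_eq_norm, ← map_sub]
    refine ((L i t).le_opNorm _).trans (le_trans ?_ hsmall)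
    gcongr; exact hi t ht
  linarith [dist_triangle4 (L₀ t x) (L₀ t y) (L i t y) (L i t x), hi' t ht]

/-- Strong convergence of uniformly bounded operators extends from a dense set. -/
theorem tendsto_apply_of_dense {F : Filter ι} {L : ι → X →L[ℂ] Z} {L₀ : X →L[ℂ] Z} {K : ℝ}
    (hL : ∀ᶠ i in F, ‖L i‖ ≤ K) {S : Set X} (hS : Dense S)
    (h : ∀ x ∈ S, Tendsto (fun i => L i x) F (𝓝 (L₀ x))) (x : X) :
    Tendsto (fun i => L i x) F (𝓝 (L₀ x)) := by
  have := tendstoUniformlyOn_of_dense (s := Set.univ) (L := fun i (_ : Unit) => L i)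
    (L₀ := fun _ => L₀) (K := max K ‖L₀‖) (F := F)
    (by filter_upwards [hL] with i hi _ _ using hi.trans (le_max_left _ _))
    (fun _ _ => le_max_right _ _) hS (fun y hy => ?_) x
  · exact this.tendsto_at (Set.mem_univ ())
  · rw [Metric.tendstoUniformlyOn_iff]
    intro ε hε
    filter_upwards [Metric.tendsto_nhds.1 (h y hy) ε hε] with i hi _ _
    rwa [dist_comm]

end StrongConvergence

/-! ### Boundedness, continuity and differentiability of orbits. -/

namespace IsC0Semigroup

variable {X : Type*} [NormedAddCommGroup X] [NormedSpace ℂ X] {T : ℝ≥0 → X →L[ℂ] X}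

theorem continuousAt_zero (hT : IsC0Semigroup T) (x : X) :
    Tendsto (fun t => T t x) (𝓝 0) (𝓝 x) := by
  have h0 : T 0 x = x := by rw [hT.map_zero]; rfl
  have h1 : ContinuousWithinAt (fun t => T t x) (Set.Ioi 0) 0 := by
    rw [ContinuousWithinAt, h0]; exact hT.tendsto_zero x
  rw [continuousWithinAt_Ioi_iff_Ici, ← bot_eq_zero, Set.Ici_bot, continuousWithinAt_univ,
    bot_eq_zero, ContinuousAt, h0] at h1
  exact h1

/-- Otherwise some `t n → 0` has `‖T (t n)‖ > n`, although every orbit converges along `t n`; this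
contradicts Banach–Steinhaus. -/
theorem exists_norm_le_near_zero [CompleteSpace X] (hT : IsC0Semigroup T) :
    ∃ δ > 0, ∃ K : ℝ, ∀ t ≤ δ, ‖T t‖ ≤ K := by
  by_contra! hcon
  have h1 : ∀ n : ℕ, ∃ t : ℝ≥0, t ≤ 1 / (n + 1) ∧ (n : ℝ) < ‖T t‖ := fun n =>
    hcon (1 / (n + 1)) (by positivity) n
  choose t ht ht' using h1
  have ht0 : Tendsto t atTop (𝓝 0) :=
    tendsto_of_tendsto_of_tendsto_of_le_of_le tendsto_const_nhds
      tendsto_one_div_add_atTop_nhds_zero_nat (fun n => zero_le) ht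
  obtain ⟨K, hK⟩ := banach_steinhaus (g := fun n => T (t n)) fun x => by
    obtain ⟨D, hD⟩ := (Metric.isBounded_range_of_tendsto _
      ((hT.continuousAt_zero x).comp ht0)).exists_norm_le
    exact ⟨D, fun n => hD _ ⟨n, rfl⟩⟩
  obtain ⟨n, hn⟩ := exists_nat_gt K
  linarith [hK n, ht' n]

theorem exists_norm_le [CompleteSpace X] (hT : IsC0Semigroup T) (t₀ : ℝ≥0) :
    ∃ K : ℝ, ∀ t ≤ t₀, ‖T t‖ ≤ K := by
  obtain ⟨δ, hδ, K, hK⟩ := hT.exists_norm_le_near_zero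
  have hK0 : 0 ≤ K := (norm_nonneg _).trans (hK 0 zero_le)
  have h : ∀ n : ℕ, ∃ D : ℝ, ∀ t ≤ n * δ, ‖T t‖ ≤ D := by
    intro n
    induction n with
    | zero => exact ⟨‖T 0‖, fun t ht => by
        rw [Nat.cast_zero, zero_mul, nonpos_iff_eq_zero] at ht; rw [ht]⟩
    | succ n ih =>
      obtain ⟨D, hD⟩ := ih
      refine ⟨max D (K * D), fun t ht => ?_⟩
      rcases le_total t (n * δ) with h | h
      · exact (hD t h).trans (le_max_left _ _)
      · obtain ⟨r, rfl⟩ := exists_add_of_le h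
        rw [add_comm, hT.map_add]
        refine (ContinuousLinearMap.opNorm_comp_le _ _).trans (le_trans ?_ (le_max_right _ _))
        gcongr
        · apply hK
          rw [Nat.cast_succ, add_mul, one_mul] at ht
          exact le_of_add_le_add_left ht
        · exact hD _ le_rfl
  obtain ⟨n, hn⟩ := exists_nat_ge (t₀ / δ)
  obtain ⟨D, hD⟩ := h n
  exact ⟨D, fun t ht => hD t (ht.trans ((div_le_iff₀ hδ).1 hn))⟩

/-- Factoring out `T` at the smaller of the two times turns right continuity at `0` into two-sided
continuity everywhere. -/
theorem norm_sub_le (hT : IsC0Semigroup T) {t₀ : ℝ≥0} {K : ℝ} (hK : ∀ t ≤ t₀, ‖T t‖ ≤ K)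
    {s t : ℝ≥0} (hs : s ≤ t₀) (ht : t ≤ t₀) (x : X) :
    ‖T t x - T s x‖ ≤ K * ‖T (nndist t s) x - x‖ := by
  wlog hst : s ≤ t generalizing s t
  · rw [norm_sub_rev, nndist_comm]
    exact this ht hs (le_of_not_ge hst)
  have h : T t x - T s x = T s (T (nndist t s) x - x) := by
    have : t = s + nndist t s := by
      rw [NNReal.nndist_eq, tsub_eq_zero_of_le hst, max_eq_left zero_le, add_tsub_cancel_of_le hst]
    conv_lhs => rw [this, hT.map_add]
    simp
  rw [h]
  exact ((T s).le_opNorm _).trans (by gcongr; exact hK s hs)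

theorem continuousOn_apply [CompleteSpace X] (hT : IsC0Semigroup T) (x : X) (t₀ : ℝ≥0) :
    ContinuousOn (fun t => T t x) (Set.Icc 0 t₀) := by
  obtain ⟨K, hK⟩ := hT.exists_norm_le t₀
  intro s hs
  rw [ContinuousWithinAt, tendsto_iff_norm_sub_tendsto_zero]
  have h1 : Tendsto (fun t : ℝ≥0 => nndist t s) (𝓝 s) (𝓝 0) := by
    have : Continuous fun t : ℝ≥0 => nndist t s := by fun_prop
    simpa using this.tendsto s
  have h2 := (((hT.continuousAt_zero x).comp h1).sub_const x).norm.const_mul K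
  rw [sub_self, norm_zero, mul_zero] at h2
  refine squeeze_zero' (Eventually.of_forall fun t => norm_nonneg _) ?_
    (h2.mono_left nhdsWithin_le_nhds)
  filter_upwards [self_mem_nhdsWithin] with t ht
  exact hT.norm_sub_le hK hs.2 ht.2 x

theorem generatorGraph_map (hT : IsC0Semigroup T) {x y : X} (h : GeneratorGraph T x y) (s : ℝ≥0) :
    GeneratorGraph T (T s x) (T s y) := by
  refine (((T s).continuous.tendsto y).comp h).congr fun t => ?_
  have h1 : T s (T t x) = T t (T s x) := by
    have := hT.map_add s t
    rw [add_comm, hT.map_add] at this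
    exact (congrArg (fun L : X →L[ℂ] X => L x) this).symm
  simp [h1]

theorem hasDerivWithinAt (hT : IsC0Semigroup T) {x y : X} (h : GeneratorGraph T x y) {s : ℝ}
    (hs : 0 ≤ s) : HasDerivWithinAt (fun r : ℝ => T r.toNNReal x) (T s.toNNReal y) (Set.Ici s) s := by
  rw [← hasDerivWithinAt_Ioi_iff_Ici, hasDerivWithinAt_iff_tendsto_slope' (by simp)]
  have h1 : Tendsto (fun z : ℝ => (z - s).toNNReal) (𝓝[>] s) (𝓝[>] 0) := by
    refine tendsto_nhdsWithin_iff.2 ⟨?_, ?_⟩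
    · have : Continuous fun z : ℝ => (z - s).toNNReal := by fun_prop
      simpa using (this.tendsto s).mono_left nhdsWithin_le_nhds
    · filter_upwards [self_mem_nhdsWithin] with z hz
      simpa using hz
  have h2 := (hT.generatorGraph_map h s.toNNReal).comp h1
  refine h2.congr' ?_
  filter_upwards [self_mem_nhdsWithin] with z hz
  have hz' : s ≤ z := le_of_lt hz
  have h3 : z.toNNReal = (z - s).toNNReal + s.toNNReal := by
    rw [← Real.toNNReal_add (sub_nonneg.2 hz') hs, sub_add_cancel]
  simp only [slope, Function.comp, vsub_eq_sub, h3, hT.map_add, ContinuousLinearMap.comp_apply]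
  rw [Real.coe_toNNReal _ (sub_nonneg.2 hz'), ← Complex.ofReal_inv, Complex.coe_smul]

end IsC0Semigroup

/-! ### The Hille–Yosida theorem. -/

namespace HilleYosida

variable {X : Type*} [NormedAddCommGroup X] [NormedSpace ℂ X] {A : X → X → Prop}
  {R : ℝ → X →L[ℂ] X} {ω C : ℝ}

/-- On the domain `l R(l) x - x = R(l) A x = O(1 / l)`; the bound `2 * C` on `l R(l)` for large `l`
and density do the rest. -/
theorem tendsto_smul_resolvent (H : HilleYosida A R ω C) (y : X) :
    Tendsto (fun l : ℝ => (l : ℂ) • R l y) atTop (𝓝 y) := by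
  have hω := H.omega_nonneg
  have hC := H.const_nonneg
  refine tendsto_apply_of_dense (L := fun l : ℝ => (l : ℂ) • R l) (L₀ := 1) (K := 2 * C) ?_
    H.dense (fun x hx => ?_) y
  · filter_upwards [eventually_gt_atTop (2 * ω)] with l hl
    rw [norm_smul, Complex.norm_real, Real.norm_of_nonneg (by linarith)]
    calc l * ‖R l‖ ≤ l * (C * (l - ω)⁻¹) := by
          have : 0 ≤ l := by linarith
          gcongr; exact H.norm_resolvent_le (by linarith)
      _ = (l * (l - ω)⁻¹) * C := by ring
      _ ≤ 2 * C := by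
          gcongr
          rw [← div_eq_mul_inv, div_le_iff₀ (by linarith)]; linarith
  · obtain ⟨z, hz⟩ := hx
    rw [one_apply_eq_self, tendsto_iff_norm_sub_tendsto_zero]
    have h1 : Tendsto (fun l : ℝ => C * (l - ω)⁻¹ * ‖z‖) atTop (𝓝 0) := by
      have h2 : Tendsto (fun l : ℝ => (l - ω)⁻¹) atTop (𝓝 0) :=
        tendsto_inv_atTop_zero.comp (tendsto_atTop_add_const_right _ (-ω) tendsto_id)
      simpa using (h2.const_mul C).mul_const ‖z‖
    refine squeeze_zero' (Eventually.of_forall fun _ => norm_nonneg _) ?_ h1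
    filter_upwards [eventually_gt_atTop ω] with l hl
    rw [_root_.smul_apply, H.smul_resolvent_sub hl hz]
    exact ((R l).le_opNorm z).trans (by gcongr; exact H.norm_resolvent_le hl)

theorem tendsto_yosida_apply (H : HilleYosida A R ω C) {x y : X} (hxy : A x y) :
    Tendsto (fun l => yosida R l x) atTop (𝓝 y) := by
  refine (H.tendsto_smul_resolvent y).congr' ?_
  filter_upwards [eventually_gt_atTop ω] with l hl
  rw [H.yosida_apply hl hxy]

variable [CompleteSpace X]

theorem uniformCauchySeqOn (H : HilleYosida A R ω C) (x : X) (t₀ : ℝ≥0) :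
    UniformCauchySeqOn (fun l (t : ℝ≥0) => opExp (yosida R l) t x) atTop (Set.Icc 0 t₀) := by
  have hω := H.omega_nonneg
  have hC := H.const_nonneg
  have hev : ∀ᶠ p : ℝ × ℝ in atTop ×ˢ atTop, 2 * ω < p.1 ∧ 2 * ω < p.2 :=
    (eventually_gt_atTop (2 * ω)).prod_mk (eventually_gt_atTop (2 * ω))
  have hb : ∀ {l : ℝ}, 2 * ω < l → ∀ t ∈ Set.Icc 0 t₀,
      ‖opExp (yosida R l) (t : ℝ≥0)‖ ≤ C * Real.exp (2 * ω * t₀) := fun hl t ht =>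
    (H.norm_opExp_yosida_le hl t.coe_nonneg).trans (by gcongr; exact ht.2)
  -- The Cauchy property is convergence of the differences to `0` along the product filter, so the
  -- density argument applies to pairs of parameters.
  have key := tendstoUniformlyOn_of_dense (F := (atTop : Filter ℝ) ×ˢ (atTop : Filter ℝ))
    (s := Set.Icc 0 t₀)
    (L := fun p (t : ℝ≥0) => opExp (yosida R p.1) t - opExp (yosida R p.2) t)
    (L₀ := fun _ => 0) (K := C * Real.exp (2 * ω * t₀) + C * Real.exp (2 * ω * t₀))
    (by
      filter_upwards [hev] with p hp t ht
      exact (norm_sub_le _ _).trans (add_le_add (hb hp.1 t ht) (hb hp.2 t ht)))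
    (fun t _ => by rw [norm_zero]; positivity) H.dense (fun y hy => ?_) x
  · rw [Metric.tendstoUniformlyOn_iff] at key
    intro u hu
    obtain ⟨ε, hε, hεu⟩ := Metric.mem_uniformity_dist.1 hu
    filter_upwards [key ε hε] with p hp t ht
    apply hεu
    have := hp t ht
    rwa [dist_comm, dist_eq_norm, zero_apply, sub_zero, sub_apply, ← dist_eq_norm] at this
  · obtain ⟨z, hz⟩ := hy
    have h1 := H.tendsto_yosida_apply hz
    have h2 : Tendsto (fun p : ℝ × ℝ => t₀ * (C * Real.exp (2 * ω * t₀)) ^ 2 *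
        ‖yosida R p.1 y - yosida R p.2 y‖) (atTop ×ˢ atTop) (𝓝 0) := by
      have := (((h1.comp tendsto_fst).sub (h1.comp (tendsto_snd (f := atTop)))).norm).const_mul
        (t₀ * (C * Real.exp (2 * ω * t₀)) ^ 2)
      simpa using this
    rw [Metric.tendstoUniformlyOn_iff]
    intro ε hε
    filter_upwards [hev, h2.eventually_lt_const hε] with p hp hpε t ht
    rw [dist_comm, dist_eq_norm, zero_apply, sub_zero, sub_apply]
    exact (H.norm_opExp_yosida_sub_le hp.1 hp.2 t.coe_nonneg (by exact_mod_cast ht.2) y).trans_lt hpε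

/-- The exponentials of the Yosida approximations converge, locally uniformly in time. -/
theorem exists_tendstoUniformlyOn (H : HilleYosida A R ω C) :
    ∃ T : ℝ≥0 → X →L[ℂ] X, ∀ x t₀, TendstoUniformlyOn
      (fun l (t : ℝ≥0) => opExp (yosida R l) t x) (fun t => T t x) atTop (Set.Icc 0 t₀) := by
  have h1 : ∀ (t : ℝ≥0) (x : X), ∃ y, Tendsto (fun l => opExp (yosida R l) t x) atTop (𝓝 y) :=
    fun t x => cauchySeq_tendsto_of_complete
      ((H.uniformCauchySeqOn x t).cauchySeq ⟨zero_le, le_rfl⟩)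
  choose S hS using h1
  refine ⟨fun t => continuousLinearMapOfTendsto (fun l => opExp (yosida R l) t) (f := S t)
    (tendsto_pi_nhds.2 (hS t)), fun x t₀ => ?_⟩
  exact (H.uniformCauchySeqOn x t₀).tendstoUniformlyOn_of_tendsto fun t _ => hS t x

/-- A semigroup with generator `A` is the limit of the exponentials of the Yosida approximations. -/
theorem tendsto_of_isSemigroupGeneratedBy (H : HilleYosida A R ω C) {T : ℝ≥0 → X →L[ℂ] X}
    (hT : IsSemigroupGeneratedBy T A) (t : ℝ≥0) (x : X) :
    Tendsto (fun l => opExp (yosida R l) t x) atTop (𝓝 (T t x)) := by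
  have hω := H.omega_nonneg
  have hC := H.const_nonneg
  obtain ⟨K, hK⟩ := hT.1.exists_norm_le t
  have hK0 : 0 ≤ K := (norm_nonneg _).trans (hK 0 zero_le)
  refine tendsto_apply_of_dense (L := fun l : ℝ => opExp (yosida R l) t)
    (K := C * Real.exp (2 * ω * t)) ?_ H.dense (fun y hy => ?_) x
  · filter_upwards [eventually_gt_atTop (2 * ω)] with l hl
    exact H.norm_opExp_yosida_le hl t.coe_nonneg
  obtain ⟨z, hz⟩ := hy
  have hcont : ContinuousOn (fun r : ℝ => T r.toNNReal y) (Set.Icc 0 t) :=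
    (hT.1.continuousOn_apply y t).comp continuous_real_toNNReal.continuousOn fun r hr =>
      ⟨zero_le, Real.toNNReal_le_iff_le_coe.2 hr.2⟩
  -- `T s` preserves the graph of its generator, which is the graph of `A`, and so commutes with the
  -- resolvents of `A`.
  have hcomm : ∀ {l : ℝ}, ω < l → ∀ s h, R l (T s h) = T s (R l h) := fun {l} hl s h => by
    have h1 := hT.1.generatorGraph_map ((hT.2 _ _).2 (H.graph_resolvent hl h)) s
    have h2 := (H.graph_iff l hl _ _).1 ((hT.2 _ _).1 h1)
    simpa using h2
  have hbound : ∀ l, 2 * ω < l → ‖T t y - opExp (yosida R l) t y‖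
      ≤ C * Real.exp (2 * ω * t) * (K * ‖z - yosida R l y‖) * t := fun l hl => by
    have h := norm_sub_opExp_le (Z := yosida R l) (v := fun r : ℝ => T r.toNNReal y)
      (v' := fun r => T r.toNNReal z)
      (D := C * Real.exp (2 * ω * t) * (K * ‖z - yosida R l y‖)) t.coe_nonneg hcont
      (fun s hs => hT.1.hasDerivWithinAt ((hT.2 _ _).2 hz) hs.1) (fun s hs => ?_)
    · have h0 : T (Real.toNNReal 0) y = y := by simp [hT.1.map_zero]
      simp only [h0, Real.toNNReal_coe] at h
      exact h
    -- By commutation the Duhamel error is `T s (z - A_l y)`, small because `A_l y → z`.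
    · have h3 : yosida R l (T s.toNNReal y) = T s.toNNReal (yosida R l y) := by
        simp [yosida, hcomm (by linarith : ω < l)]
      rw [h3, ← map_sub]
      refine (ContinuousLinearMap.le_opNorm _ _).trans ?_
      gcongr
      · refine (H.norm_opExp_yosida_le hl (by linarith [hs.2])).trans ?_
        gcongr
        linarith [hs.1]
      · refine (ContinuousLinearMap.le_opNorm _ _).trans ?_
        gcongr
        exact hK _ (Real.toNNReal_le_iff_le_coe.2 hs.2.le)
  rw [tendsto_iff_norm_sub_tendsto_zero]
  have hlim : Tendsto (fun l => C * Real.exp (2 * ω * t) * (K * ‖z - yosida R l y‖) * t) atTop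
      (𝓝 0) := by
    have h4 := (((H.tendsto_yosida_apply hz).const_sub z).norm.const_mul K).const_mul
      (C * Real.exp (2 * ω * t))
    simpa using h4.mul_const (t : ℝ)
  refine squeeze_zero' (Eventually.of_forall fun _ => norm_nonneg _) ?_ hlim
  filter_upwards [eventually_gt_atTop (2 * ω)] with l hl
  rw [norm_sub_rev]
  exact hbound l hl

theorem norm_le_of_isSemigroupGeneratedBy (H : HilleYosida A R ω C) {T : ℝ≥0 → X →L[ℂ] X}
    (hT : IsSemigroupGeneratedBy T A) (t : ℝ≥0) : ‖T t‖ ≤ C * Real.exp (2 * ω * t) := by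
  have hC := H.const_nonneg
  refine ContinuousLinearMap.opNorm_le_bound _ (by positivity) fun x => ?_
  refine le_of_tendsto (H.tendsto_of_isSemigroupGeneratedBy hT t x).norm ?_
  filter_upwards [eventually_gt_atTop (2 * ω)] with l hl
  exact (ContinuousLinearMap.le_opNorm _ _).trans
    (by gcongr; exact H.norm_opExp_yosida_le hl t.coe_nonneg)

/-- The rate of convergence of the Yosida approximations on the domain of `A²`. -/
theorem norm_opExp_yosida_sub_semigroup_le (H : HilleYosida A R ω C) {T : ℝ≥0 → X →L[ℂ] X}
    (hT : IsSemigroupGeneratedBy T A) {t t₀ : ℝ≥0} (ht : t ≤ t₀) {x y z : X} (hxy : A x y)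
    (hyz : A y z) {l : ℝ} (hl : 2 * ω < l) :
    ‖opExp (yosida R l) t x - T t x‖
      ≤ t₀ * (C * Real.exp (2 * ω * t₀)) ^ 2 * (C * (l - ω)⁻¹ * ‖z‖) := by
  have hω := H.omega_nonneg
  have hC := H.const_nonneg
  have hlω : ω < l := by linarith
  have h1 : Tendsto (fun k => ‖opExp (yosida R l) t x - opExp (yosida R k) t x‖) atTop
      (𝓝 ‖opExp (yosida R l) t x - T t x‖) :=
    ((H.tendsto_of_isSemigroupGeneratedBy hT t x).const_sub _).norm
  have h2 : Tendsto (fun k => t₀ * (C * Real.exp (2 * ω * t₀)) ^ 2 *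
      ‖yosida R l x - yosida R k x‖) atTop
      (𝓝 (t₀ * (C * Real.exp (2 * ω * t₀)) ^ 2 * ‖yosida R l x - y‖)) :=
    ((H.tendsto_yosida_apply hxy).const_sub _).norm.const_mul _
  have h3 := le_of_tendsto_of_tendsto h1 h2 (by
    filter_upwards [eventually_gt_atTop (2 * ω)] with k hk
    exact H.norm_opExp_yosida_sub_le hl hk t.coe_nonneg (by exact_mod_cast ht) x)
  refine h3.trans ?_
  -- Here `A_l x - y = l R(l) y - y = R(l) z`, and the resolvent supplies the factor `1 / (l - ω)`.
  rw [H.yosida_apply hlω hxy, H.smul_resolvent_sub hlω hyz]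
  gcongr
  exact ((R l).le_opNorm z).trans (by gcongr; exact H.norm_resolvent_le hlω)

/-- **Hille–Yosida**: the operator generates a `C₀`-semigroup. -/
theorem exists_isSemigroupGeneratedBy (H : HilleYosida A R ω C) :
    ∃ T : ℝ≥0 → X →L[ℂ] X, IsSemigroupGeneratedBy T A := by
  have hω := H.omega_nonneg
  have hC := H.const_nonneg
  obtain ⟨T, hT⟩ := H.exists_tendstoUniformlyOn
  have hlim : ∀ (t : ℝ≥0) x, Tendsto (fun l => opExp (yosida R l) t x) atTop (𝓝 (T t x)) :=
    fun t x => (hT x t).tendsto_at ⟨zero_le, le_rfl⟩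
  have hbound : ∀ {l : ℝ}, 2 * ω < l → ∀ {t t₀ : ℝ≥0}, t ≤ t₀ →
      ‖opExp (yosida R l) (t : ℝ)‖ ≤ C * Real.exp (2 * ω * t₀) := fun hl t t₀ h =>
    (H.norm_opExp_yosida_le hl t.coe_nonneg).trans (by gcongr)
  have hcont : ∀ x, Tendsto (fun t => T t x) (𝓝 0) (𝓝 x) := fun x => by
    have hc : ContinuousOn (fun t => T t x) (Set.Icc 0 1) := by
      refine (hT x 1).continuousOn (Eventually.of_forall fun l => ?_).frequently
      exact ((continuous_opExp_apply (yosida R l) x).comp NNReal.continuous_coe).continuousOn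
    have h0 : T 0 x = x := by
      refine tendsto_nhds_unique (hlim 0 x) ?_
      simp [opExp_zero]
    have h1 := (hc 0 ⟨le_rfl, zero_le⟩).continuousAt
      (by rw [← bot_eq_zero, Set.Icc_bot]; exact Iic_mem_nhds zero_lt_one)
    rw [ContinuousAt, h0] at h1
    exact h1
  have hsg : IsC0Semigroup T := by
    refine ⟨?_, fun t s => ?_, fun x => (hcont x).mono_left nhdsWithin_le_nhds⟩
    · ext x
      refine tendsto_nhds_unique (hlim 0 x) ?_
      simp [opExp_zero]
    · ext x
      refine tendsto_nhds_unique (hlim (t + s) x) ?_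
      have h1 : Tendsto (fun l => opExp (yosida R l) t (opExp (yosida R l) s x - T s x)) atTop
          (𝓝 0) := by
        have h2 := ((hlim s x).sub_const (T s x)).norm.const_mul (C * Real.exp (2 * ω * t))
        rw [sub_self, norm_zero, mul_zero] at h2
        refine squeeze_zero_norm' ?_ h2
        filter_upwards [eventually_gt_atTop (2 * ω)] with l hl
        exact (ContinuousLinearMap.le_opNorm _ _).trans (by gcongr; exact hbound hl le_rfl)
      have h3 := h1.add (hlim t (T s x))
      rw [zero_add] at h3
      refine h3.congr fun l => ?_
      rw [NNReal.coe_add, opExp_add]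
      simp
  have hsub : ∀ f g, A f g → GeneratorGraph T f g := fun x y hxy => by
    rw [GeneratorGraph, tendsto_iff_norm_sub_tendsto_zero]
    refine Metric.tendsto_nhds.2 fun ε hε => ?_
    have hε3 : 0 < ε / 2 := by positivity
    have hy := Metric.tendsto_nhds.1 (hcont y) (ε / 2) hε3
    obtain ⟨δ, hδ, hδy⟩ := Metric.eventually_nhds_iff.1 hy
    have hU : TendstoUniformlyOn (fun l (t : ℝ≥0) => opExp (yosida R l) t (yosida R l x))
        (fun t => T t y) atTop (Set.Icc 0 1) := by
      rw [Metric.tendstoUniformlyOn_iff]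
      intro η hη
      have h2 := ((H.tendsto_yosida_apply hxy).sub_const y).norm.const_mul
        (C * Real.exp (2 * ω * (1 : ℝ≥0)))
      rw [sub_self, norm_zero, mul_zero] at h2
      filter_upwards [Metric.tendstoUniformlyOn_iff.1 (hT y 1) (η / 2) (by positivity),
        h2.eventually_lt_const (by positivity : 0 < η / 2), eventually_gt_atTop (2 * ω)]
        with l h3 h4 hl t ht
      have h5 : dist (opExp (yosida R l) t y) (opExp (yosida R l) t (yosida R l x)) < η / 2 := by
        rw [dist_comm, dist_eq_norm, ← map_sub]
        exact ((ContinuousLinearMap.le_opNorm _ _).trans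
          (by gcongr; exact hbound hl ht.2)).trans_lt h4
      linarith [dist_triangle (T t y) (opExp (yosida R l) t y)
        (opExp (yosida R l) t (yosida R l x)), h3 t ht]
    have hnear : ∀ᶠ t : ℝ≥0 in 𝓝[>] 0, t < min 1 δ.toNNReal ∧ 0 < t := by
      refine (eventually_nhdsWithin_of_eventually_nhds (eventually_lt_nhds ?_)).and
        self_mem_nhdsWithin
      exact lt_min zero_lt_one (Real.toNNReal_pos.2 hδ)
    filter_upwards [hnear] with t ht
    have ht1 : t ≤ 1 := (ht.1.trans_le (min_le_left _ _)).le
    have htδ : (t : ℝ) < δ := Real.lt_toNNReal_iff_coe_lt.1 (ht.1.trans_le (min_le_right _ _))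
    have ht0 : (0 : ℝ) < t := ht.2
    -- The derivative of `s ↦ exp (s A_l) x - s y` is `exp (s A_l) A_l x - y`. For large `l` it is
    -- within `η` of `T s y - y`, which is below `ε / 2` on `[0, t]`. Since `l → ∞` is taken with
    -- `t` fixed, the bound passes to `T`.
    have hmain : ∀ η > 0, ‖T t x - x - (t : ℝ) • y‖ ≤ (ε / 2 + η) * t := fun η hη => by
      have h6 : Tendsto (fun l => ‖opExp (yosida R l) t x - x - (t : ℝ) • y‖) atTop
          (𝓝 ‖T t x - x - (t : ℝ) • y‖) := (((hlim t x).sub_const x).sub_const _).norm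
      refine le_of_tendsto h6 ?_
      filter_upwards [Metric.tendstoUniformlyOn_iff.1 hU η hη] with l hl
      have h7 := norm_image_sub_le_of_norm_deriv_right_le_segment (a := 0) (b := (t : ℝ))
        (f := fun s : ℝ => opExp (yosida R l) s x - s • y)
        (f' := fun s => opExp (yosida R l) s (yosida R l x) - (1 : ℝ) • y) (C := ε / 2 + η)
        (((continuous_opExp_apply _ _).sub (by fun_prop)).continuousOn)
        (fun s _ => ((hasDerivAt_opExp_apply _ _ _).sub
          ((hasDerivAt_id s).smul_const y)).hasDerivWithinAt) (fun s hs => ?_) t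
        ⟨t.coe_nonneg, le_rfl⟩
      · simp only [opExp_zero, one_apply_eq_self, zero_smul, sub_zero] at h7
        rwa [sub_right_comm] at h7
      · lift s to ℝ≥0 using hs.1
        have hst : s ≤ t := by exact_mod_cast hs.2.le
        have h8 := hl s ⟨zero_le, hst.trans ht1⟩
        have h9 : dist (T s y) y < ε / 2 := hδy (by
          rw [NNReal.dist_eq, NNReal.coe_zero, sub_zero, abs_of_nonneg s.coe_nonneg]
          exact lt_of_le_of_lt (by exact_mod_cast hst) htδ)
        rw [one_smul, ← dist_eq_norm]
        rw [dist_comm] at h8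
        linarith [dist_triangle (opExp (yosida R l) s (yosida R l x)) (T s y) y]
    have h10 : ‖T t x - x - (t : ℝ) • y‖ ≤ ε / 2 * t := by
      refine le_of_forall_pos_le_add fun η hη => (hmain (η / t) (by positivity)).trans_eq ?_
      field_simp
    have h11 : ((t : ℝ) : ℂ)⁻¹ • (T t x - x) - y = (t : ℝ)⁻¹ • (T t x - x - (t : ℝ) • y) := by
      rw [← Complex.ofReal_inv, Complex.coe_smul, smul_sub _ (T t x - x), smul_smul,
        inv_mul_cancel₀ ht0.ne', one_smul]
    rw [dist_zero_right, norm_norm, h11, norm_smul, norm_inv, Real.norm_of_nonneg ht0.le]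
    calc (t : ℝ)⁻¹ * ‖T t x - x - (t : ℝ) • y‖ ≤ (t : ℝ)⁻¹ * (ε / 2 * t) := by gcongr
      _ = ε / 2 := by field_simp
      _ < ε := by linarith
  refine ⟨T, hsg, fun f g => ⟨fun hfg => ?_, hsub f g⟩⟩
  -- The generator is no larger than `A`: the resolvent commutes with `T`, so the generator maps `R
  -- f` to `R g`; it also maps `R f` to `l R f - f`. Comparing the two gives `f = R (l f - g)`,
  -- which lies in the domain of `A`.
  have hl : ω < ω + 1 := by linarith
  have hcomm : ∀ t x, R (ω + 1) (T t x) = T t (R (ω + 1) x) := fun t x => by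
    refine tendsto_nhds_unique (((R (ω + 1)).continuous.tendsto _).comp (hlim t x)) ?_
    refine (hlim t (R (ω + 1) x)).congr' ?_
    filter_upwards [eventually_gt_atTop ω] with l hl'
    exact (congrArg (fun L : X →L[ℂ] X => L x)
      ((H.commute_yosida hl' hl).opExp_right (t : ℝ)).eq).symm
  have h1 := hsub _ _ (H.graph_resolvent hl f)
  have h2 : GeneratorGraph T (R (ω + 1) f) (R (ω + 1) g) := by
    refine (((R (ω + 1)).continuous.tendsto _).comp hfg).congr fun t => ?_
    simp [hcomm]
  have h3 := tendsto_nhds_unique h1 h2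
  rw [H.graph_iff _ hl, map_sub, map_smul, ← h3]
  abel

end HilleYosida

/-! ### The Trotter–Kato theorem on varying spaces. -/

section TrotterKato

variable {X : Type*} [NormedAddCommGroup X] [NormedSpace ℂ X]
  {A : X → X → Prop} {R : ℝ → X →L[ℂ] X} {ω C : ℝ}
  {Xn : ℕ → Type*} [∀ n, NormedAddCommGroup (Xn n)] [∀ n, NormedSpace ℂ (Xn n)]
  {An : ∀ n, Xn n → Xn n → Prop} {Rn : ∀ n, ℝ → Xn n →L[ℂ] Xn n}
  {E : ∀ n, Xn n →L[ℂ] X} {P : ∀ n, X →L[ℂ] Xn n}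

theorem norm_apply_le_of_norm_le_one {V W : Type*} [NormedAddCommGroup V] [NormedSpace ℂ V]
    [NormedAddCommGroup W] [NormedSpace ℂ W] {L : V →L[ℂ] W} (hL : ‖L‖ ≤ 1) (x : V) :
    ‖L x‖ ≤ ‖x‖ :=
  (L.le_of_opNorm_le hL x).trans_eq (one_mul _)

theorem norm_resolvent_pow_conj_le (Hn : ∀ n, HilleYosida (An n) (Rn n) ω C)
    (hE : ∀ n, ‖E n‖ ≤ 1) (hP : ∀ n, ‖P n‖ ≤ 1) {l : ℝ} (hl : ω < l) (k n : ℕ) (x : X) :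
    ‖E n ((Rn n l ^ k) (P n x))‖ ≤ C * (l - ω)⁻¹ ^ k * ‖x‖ := by
  have hC := (Hn 0).const_nonneg
  have hd : 0 < l - ω := by linarith
  refine (norm_apply_le_of_norm_le_one (hE n) _).trans
    (((Rn n l ^ k).le_opNorm _).trans ?_)
  gcongr
  · exact (Hn n).norm_pow_le l hl k
  · exact norm_apply_le_of_norm_le_one (hP n) x

/-- Because `P E = 1`, the conjugate `E Rₙ^(k+1) P` is the product of `E Rₙ P` and `E Rₙ^k P`, and
strong limits of uniformly bounded operators multiply. -/
theorem tendsto_resolvent_pow_conj (Hn : ∀ n, HilleYosida (An n) (Rn n) ω C)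
    (hE : ∀ n, ‖E n‖ ≤ 1) (hP : ∀ n, ‖P n‖ ≤ 1) (hPE : ∀ n y, P n (E n y) = y)
    (hEP : ∀ x, Tendsto (fun n => E n (P n x)) atTop (𝓝 x)) {l : ℝ} (hl : ω < l)
    (hR : ∀ x, Tendsto (fun n => E n (Rn n l (P n x))) atTop (𝓝 (R l x))) (k : ℕ) (x : X) :
    Tendsto (fun n => E n ((Rn n l ^ k) (P n x))) atTop (𝓝 ((R l ^ k) x)) := by
  induction k with
  | zero => simpa using hEP x
  | succ k ih =>
    have h1 : Tendsto (fun n => E n (Rn n l (P n (E n ((Rn n l ^ k) (P n x)) - (R l ^ k) x))))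
        atTop (𝓝 0) := by
      have h2 := (ih.sub_const ((R l ^ k) x)).norm.const_mul (C * (l - ω)⁻¹)
      rw [sub_self, norm_zero, mul_zero] at h2
      refine squeeze_zero_norm (fun n => ?_) h2
      simpa using norm_resolvent_pow_conj_le Hn hE hP hl 1 n
        (E n ((Rn n l ^ k) (P n x)) - (R l ^ k) x)
    have h3 := h1.add (hR ((R l ^ k) x))
    rw [zero_add] at h3
    rw [pow_succ']
    refine h3.congr fun n => ?_
    simp [pow_succ', hPE]

theorem HilleYosida.dense_range_resolvent_sq (H : HilleYosida A R ω C) {l : ℝ} (hl : ω < l) :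
    DenseRange fun z => R l (R l z) := by
  have h1 : DenseRange (R l) := by
    refine H.dense.mono ?_
    rintro f ⟨g, hfg⟩
    exact ⟨_, (H.graph_iff l hl f g).1 hfg⟩
  exact h1.comp h1 (R l).continuous

/-- The square of the generator on the range of the squared resolvent. -/
theorem HilleYosida.exists_graph_resolvent_sq (H : HilleYosida A R ω C) {l : ℝ} (hl : ω < l)
    (z : X) : ∃ y w, A (R l (R l z)) y ∧ A y w ∧
      ‖w‖ ≤ (‖(l : ℂ)‖ * (C * (l - ω)⁻¹) + 1) ^ 2 * ‖z‖ := by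
  set D : X →L[ℂ] X := (l : ℂ) • R l - 1 with hD
  have hDn : ‖D‖ ≤ ‖(l : ℂ)‖ * (C * (l - ω)⁻¹) + 1 := by
    refine (norm_sub_le _ _).trans (add_le_add ?_ ContinuousLinearMap.norm_id_le)
    rw [norm_smul]
    gcongr
    exact H.norm_resolvent_le hl
  have hDA : ∀ h, A (R l h) (D h) := fun h => by
    simpa [hD] using H.graph_resolvent hl h
  refine ⟨D (R l z), D (D z), hDA _, ?_, ?_⟩
  · have : D (R l z) = R l (D z) := by simp [hD]
    rw [this]
    exact hDA _
  · rw [pow_two, mul_assoc]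
    have h0 := (norm_nonneg _).trans hDn
    refine (D.le_opNorm _).trans ?_
    gcongr
    exact (D.le_opNorm _).trans (by gcongr)

variable [CompleteSpace X] [∀ n, CompleteSpace (Xn n)]

theorem hasSum_opExp_apply {V : Type*} [NormedAddCommGroup V] [NormedSpace ℂ V] [CompleteSpace V]
    (Z : V →L[ℂ] V) (r : ℝ) (x : V) :
    HasSum (fun k : ℕ => ((k.factorial : ℂ)⁻¹ * (r : ℂ) ^ k) • (Z ^ k) x) (opExp Z r x) := by
  have h1 : HasSum (fun k : ℕ => ((k.factorial : ℂ)⁻¹) • ((r : ℂ) • Z) ^ k) (opExp Z r) :=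
    NormedSpace.exp_series_hasSum_exp' _
  refine (h1.mapL (ContinuousLinearMap.apply ℂ V x)).congr_fun fun k => ?_
  rw [ContinuousLinearMap.apply_apply, _root_.smul_apply, smul_pow, _root_.smul_apply, mul_smul]

/-- For fixed `l` the exponential is a power series in the resolvent, whose terms converge and are
dominated independently of `n`. Up to the scalar `exp (-t l)`, of modulus at most `1`, the
coefficients at time `t ≤ t₀` are bounded by those at `t₀`, hence uniformity in `t`. -/
theorem tendstoUniformlyOn_opExp_yosida_conj (H : HilleYosida A R ω C)
    (Hn : ∀ n, HilleYosida (An n) (Rn n) ω C)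
    (hE : ∀ n, ‖E n‖ ≤ 1) (hP : ∀ n, ‖P n‖ ≤ 1) (hPE : ∀ n y, P n (E n y) = y)
    (hEP : ∀ x, Tendsto (fun n => E n (P n x)) atTop (𝓝 x)) {l : ℝ} (hl : 2 * ω < l)
    (hR : ∀ x, Tendsto (fun n => E n (Rn n l (P n x))) atTop (𝓝 (R l x))) (x : X) (t₀ : ℝ≥0) :
    TendstoUniformlyOn (fun n (t : ℝ≥0) => E n (opExp (yosida (Rn n) l) t (P n x)))
      (fun t => opExp (yosida R l) t x) atTop (Set.Icc 0 t₀) := by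
  have hω := H.omega_nonneg
  have hC := H.const_nonneg
  have hl' : ω < l := by linarith
  have hl0 : 0 ≤ l := by linarith
  have hd : 0 < l - ω := by linarith
  set r₀ : ℝ := t₀ * l ^ 2 with hr₀
  have hr₀0 : 0 ≤ r₀ := by positivity
  have hpow := tendsto_resolvent_pow_conj Hn hE hP hPE hEP hl' hR
  set d : ℕ → ℕ → ℝ := fun n k => (k.factorial : ℝ)⁻¹ * r₀ ^ k *
    ‖E n ((Rn n l ^ k) (P n x)) - (R l ^ k) x‖ with hd'
  set b : ℕ → ℝ := fun k => 2 * C * ‖x‖ * ((k.factorial : ℝ)⁻¹ • (r₀ * (l - ω)⁻¹) ^ k) with hb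
  have hbsum : Summable b :=
    ((NormedSpace.exp_series_hasSum_exp' (𝕂 := ℝ) (r₀ * (l - ω)⁻¹)).mul_left _).summable
  have hdb : ∀ n k, d n k ≤ b k := fun n k => by
    have h1 := norm_resolvent_pow_conj_le Hn hE hP hl' k n x
    have h2 : ‖(R l ^ k) x‖ ≤ C * (l - ω)⁻¹ ^ k * ‖x‖ :=
      ((R l ^ k).le_opNorm x).trans (by gcongr; exact H.norm_pow_le l hl' k)
    calc d n k ≤ (k.factorial : ℝ)⁻¹ * r₀ ^ k *
          (C * (l - ω)⁻¹ ^ k * ‖x‖ + C * (l - ω)⁻¹ ^ k * ‖x‖) := by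
          simp only [hd']; gcongr; exact (norm_sub_le _ _).trans (add_le_add h1 h2)
      _ = b k := by simp only [hb, smul_eq_mul, mul_pow]; ring
  have hd0 : ∀ n k, 0 ≤ d n k := fun n k => by positivity
  have hdsum : ∀ n, Summable (d n) := fun n => Summable.of_nonneg_of_le (hd0 n) (hdb n) hbsum
  have hlim : Tendsto (fun n => ∑' k, d n k) atTop (𝓝 0) := by
    have h3 := tendsto_tsum_of_dominated_convergence (𝓕 := atTop) (f := d) (g := fun _ => 0) hbsum
      (fun k => by
        have h4 := ((hpow k x).sub_const ((R l ^ k) x)).norm.const_mul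
          ((k.factorial : ℝ)⁻¹ * r₀ ^ k)
        rwa [sub_self, norm_zero, mul_zero] at h4)
      (Eventually.of_forall fun n k => by
        rw [Real.norm_of_nonneg (hd0 n k)]; exact hdb n k)
    simpa using h3
  rw [Metric.tendstoUniformlyOn_iff]
  intro ε hε
  filter_upwards [hlim.eventually_lt_const hε] with n hn t ht
  refine lt_of_le_of_lt ?_ hn
  have hr : t * l ^ 2 ≤ r₀ := by
    have : (t : ℝ) ≤ t₀ := by exact_mod_cast ht.2
    rw [hr₀]; gcongr
  have hr0 : 0 ≤ t * l ^ 2 := by positivity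
  have h5 := ((hasSum_opExp_apply (Rn n l) (t * l ^ 2) (P n x)).mapL (E n)).sub
    (hasSum_opExp_apply (R l) (t * l ^ 2) x)
  have h6 : ‖E n (opExp (Rn n l) (t * l ^ 2) (P n x)) - opExp (R l) (t * l ^ 2) x‖
      ≤ ∑' k, d n k := by
    refine h5.norm_le_of_bounded (hdsum n).hasSum fun k => ?_
    rw [map_smul, ← smul_sub, norm_smul, norm_mul, norm_inv, norm_pow, Complex.norm_natCast,
      Complex.norm_real, Real.norm_of_nonneg hr0]
    simp only [hd']
    gcongr
  rw [dist_comm, dist_eq_norm, HilleYosida.opExp_yosida, HilleYosida.opExp_yosida,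
    _root_.smul_apply, _root_.smul_apply, map_smul, ← smul_sub, norm_smul]
  have h7 : ‖Complex.exp (-((t : ℝ) * l))‖ ≤ 1 := by
    rw [Complex.norm_exp]
    have : 0 ≤ (t : ℝ) * l := by positivity
    simpa using this
  calc _ ≤ 1 * ‖E n (opExp (Rn n l) (t * l ^ 2) (P n x)) - opExp (R l) (t * l ^ 2) x‖ := by
        gcongr
    _ ≤ _ := by rw [one_mul]; exact h6

/-- **Trotter–Kato**: strong convergence of the resolvents implies convergence of the semigroups,
uniformly on bounded time intervals. -/
theorem tendstoUniformlyOn_of_resolvent (H : HilleYosida A R ω C)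
    (Hn : ∀ n, HilleYosida (An n) (Rn n) ω C)
    (hE : ∀ n, ‖E n‖ ≤ 1) (hP : ∀ n, ‖P n‖ ≤ 1) (hPE : ∀ n y, P n (E n y) = y)
    (hEP : ∀ x, Tendsto (fun n => E n (P n x)) atTop (𝓝 x))
    (hR : ∀ l, ω < l → ∀ x, Tendsto (fun n => E n (Rn n l (P n x))) atTop (𝓝 (R l x)))
    {T : ℝ≥0 → X →L[ℂ] X} (hT : IsSemigroupGeneratedBy T A)
    {Tn : ∀ n, ℝ≥0 → Xn n →L[ℂ] Xn n} (hTn : ∀ n, IsSemigroupGeneratedBy (Tn n) (An n))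
    (x : X) (t₀ : ℝ≥0) :
    TendstoUniformlyOn (fun n t => E n (Tn n t (P n x))) (fun t => T t x) atTop
      (Set.Icc 0 t₀) := by
  have hω := H.omega_nonneg
  have hC := H.const_nonneg
  set K : ℝ := C * Real.exp (2 * ω * t₀) with hKdef
  have hK0 : 0 ≤ K := by positivity
  have hexp : ∀ t ∈ Set.Icc 0 t₀, C * Real.exp (2 * ω * (t : ℝ≥0)) ≤ K := fun t ht => by
    have : (t : ℝ) ≤ t₀ := by exact_mod_cast ht.2
    rw [hKdef]; gcongr
  have hTK : ∀ t ∈ Set.Icc 0 t₀, ‖T t‖ ≤ K := fun t ht =>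
    (H.norm_le_of_isSemigroupGeneratedBy hT t).trans (hexp t ht)
  have hTnK : ∀ n, ∀ t ∈ Set.Icc 0 t₀, ‖Tn n t‖ ≤ K := fun n t ht =>
    ((Hn n).norm_le_of_isSemigroupGeneratedBy (hTn n) t).trans (hexp t ht)
  have hl₀ : ω < ω + 1 := by linarith
  refine tendstoUniformlyOn_of_dense (L := fun n t => E n ∘L Tn n t ∘L P n) (K := K)
    (Eventually.of_forall fun n t ht => ?_) hTK (H.dense_range_resolvent_sq hl₀) ?_ x
  · refine ContinuousLinearMap.opNorm_le_bound _ hK0 fun y => ?_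
    refine (norm_apply_le_of_norm_le_one (hE n) _).trans ((Tn n t).le_opNorm _ |>.trans ?_)
    gcongr
    · exact hTnK n t ht
    · exact norm_apply_le_of_norm_le_one (hP n) y
  rintro _ ⟨z, rfl⟩
  set x₀ := R (ω + 1) (R (ω + 1) z) with hx₀
  -- `P n x₀` need not lie in the domain of `An n`. Its substitute `xn n` lies in the domain of the
  -- square, with a bound on the square's value uniform in `n`, so the Yosida rate holds for all `n`
  -- simultaneously.
  set xn : ∀ n, Xn n := fun n => Rn n (ω + 1) (Rn n (ω + 1) (P n z)) with hxn
  have hxn_lim : Tendsto (fun n => ‖P n x₀ - xn n‖) atTop (𝓝 0) := by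
    have h1 := tendsto_resolvent_pow_conj Hn hE hP hPE hEP hl₀ (hR _ hl₀) 2 z
    have h2 := (h1.const_sub x₀).norm
    simp only [pow_two, mul_apply_eq_comp] at h2
    rw [← hx₀, sub_self, norm_zero] at h2
    refine squeeze_zero (fun _ => norm_nonneg _) (fun n => ?_) h2
    have h3 : P n x₀ - xn n = P n (x₀ - E n (xn n)) := by rw [map_sub, hPE]
    rw [h3]
    exact norm_apply_le_of_norm_le_one (hP n) _
  set D : ℝ := (‖((ω + 1 : ℝ) : ℂ)‖ * (C * (ω + 1 - ω)⁻¹) + 1) ^ 2 * ‖z‖ with hDdef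
  have hD0 : 0 ≤ D := by positivity
  have hrate : Tendsto (fun l : ℝ => t₀ * K ^ 2 * (C * (l - ω)⁻¹ * D)) atTop (𝓝 0) := by
    have h2 : Tendsto (fun l : ℝ => (l - ω)⁻¹) atTop (𝓝 0) :=
      tendsto_inv_atTop_zero.comp (tendsto_atTop_add_const_right _ (-ω) tendsto_id)
    simpa using ((h2.const_mul C).mul_const D).const_mul (t₀ * K ^ 2)
  rw [Metric.tendstoUniformlyOn_iff]
  intro ε hε
  -- First `l` is fixed, independently of `n`; then `n → ∞`. The five errors are the Yosida error on
  -- `X`, the Yosida error on `Xn n`, the convergence at fixed `l`, and twice the replacement of `P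
  -- n x₀` by `xn n`.
  obtain ⟨l, hlrate, hl⟩ := ((hrate.eventually_lt_const (by positivity : 0 < ε / 5)).and
    (eventually_gt_atTop (2 * ω))).exists
  have hl' : 0 < l - ω := by linarith
  have hY := Metric.tendstoUniformlyOn_iff.1 (tendstoUniformlyOn_opExp_yosida_conj H Hn hE hP hPE
    hEP hl (hR l (by linarith)) x₀ t₀) (ε / 5) (by positivity)
  have hxn' := (hxn_lim.const_mul K).eventually_lt_const (u := ε / 5)
    (by rw [mul_zero]; positivity)
  have hTr : ∀ t ∈ Set.Icc 0 t₀, ‖opExp (yosida R l) (t : ℝ≥0) x₀ - T t x₀‖ < ε / 5 :=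
    fun t ht => by
      obtain ⟨y, w, hy, hw, hwz⟩ := H.exists_graph_resolvent_sq hl₀ z
      refine lt_of_le_of_lt ?_ hlrate
      refine (H.norm_opExp_yosida_sub_semigroup_le hT ht.2 hy hw hl).trans ?_
      gcongr
  have hTnr : ∀ n, ∀ t ∈ Set.Icc 0 t₀,
      ‖opExp (yosida (Rn n) l) (t : ℝ≥0) (xn n) - Tn n t (xn n)‖ < ε / 5 := fun n t ht => by
    obtain ⟨y, w, hy, hw, hwz⟩ := (Hn n).exists_graph_resolvent_sq hl₀ (P n z)
    refine lt_of_le_of_lt ?_ hlrate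
    refine ((Hn n).norm_opExp_yosida_sub_semigroup_le (hTn n) ht.2 hy hw hl).trans ?_
    gcongr
    refine hwz.trans ?_
    rw [hDdef]
    gcongr
    exact norm_apply_le_of_norm_le_one (hP n) z
  filter_upwards [hY, hxn'] with n hYn hxnn t ht
  have e1 := hTr t ht
  have e2 := hYn t ht
  have e3 : ‖opExp (yosida (Rn n) l) (t : ℝ≥0) (P n x₀ - xn n)‖ < ε / 5 := by
    refine lt_of_le_of_lt ((ContinuousLinearMap.le_opNorm _ _).trans ?_) hxnn
    gcongr
    exact ((Hn n).norm_opExp_yosida_le hl t.coe_nonneg).trans (hexp t ht)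
  have e4 := hTnr n t ht
  have e5 : ‖Tn n t (P n x₀ - xn n)‖ < ε / 5 := by
    refine lt_of_le_of_lt ((ContinuousLinearMap.le_opNorm _ _).trans ?_) hxnn
    gcongr
    exact hTnK n t ht
  have e6 : opExp (yosida (Rn n) l) (t : ℝ) (P n x₀) - Tn n t (P n x₀)
      = opExp (yosida (Rn n) l) (t : ℝ) (P n x₀ - xn n)
        + (opExp (yosida (Rn n) l) (t : ℝ) (xn n) - Tn n t (xn n)) - Tn n t (P n x₀ - xn n) := by
    rw [map_sub, map_sub]; abel
  have e7 : ‖E n (opExp (yosida (Rn n) l) (t : ℝ) (P n x₀)) - E n (Tn n t (P n x₀))‖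
      < ε / 5 + ε / 5 + ε / 5 := by
    rw [← map_sub]
    refine (norm_apply_le_of_norm_le_one (hE n) _).trans_lt ?_
    rw [e6]
    refine (norm_sub_le _ _).trans_lt (add_lt_add ((norm_add_le _ _).trans_lt (add_lt_add e3 e4)) e5)
  rw [← dist_eq_norm, dist_comm] at e1
  rw [← dist_eq_norm] at e7
  have e8 := dist_triangle4 (T t x₀) (opExp (yosida R l) (t : ℝ) x₀)
    (E n (opExp (yosida (Rn n) l) (t : ℝ) (P n x₀))) (E n (Tn n t (P n x₀)))
  simp only [ContinuousLinearMap.comp_apply]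
  linarith

end TrotterKato

/-! ### Primitives and the abstract boundary value operator. -/

section Volterra

variable {Y : Type*} [NormedAddCommGroup Y]

instance : IsProbabilityMeasure unitMeasure := ⟨by simp⟩

theorem ae_mem_unitInterval : ∀ᵐ s ∂unitMeasure, s ∈ Set.Icc (0 : ℝ) 1 :=
  ae_restrict_mem measurableSet_Icc

theorem intervalIntegrable_of_unitMeasure {f : ℝ → Y} (hf : Integrable f unitMeasure) {s : ℝ}
    (hs : s ∈ Set.Icc (0 : ℝ) 1) : IntervalIntegrable f volume 0 s := by
  have h : IntegrableOn f (Set.uIcc 0 s) := by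
    refine IntegrableOn.mono_set (t := Set.Icc (0 : ℝ) 1) hf ?_
    rw [Set.uIcc_of_le hs.1]
    exact Set.Icc_subset_Icc_right hs.2
  exact h.intervalIntegrable

theorem memLp_unitMeasure_of_continuousOn {f : ℝ → Y} (hf : ContinuousOn f (Set.Icc 0 1)) :
    MemLp f 1 unitMeasure :=
  memLp_one_iff_integrable.2 (hf.integrableOn_compact isCompact_Icc)

theorem norm_le_of_ae_bound_unitMeasure {f : Lp Y 1 unitMeasure} {D : ℝ} (hD : 0 ≤ D)
    (h : ∀ᵐ s ∂unitMeasure, ‖f s‖ ≤ D) : ‖f‖ ≤ D := by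
  refine (Lp.norm_le_of_ae_bound hD h).trans_eq ?_
  simp [measureUnivNNReal]

variable [NormedSpace ℂ Y]

theorem integral_congr_unitMeasure {f g : ℝ → Y} (h : f =ᵐ[unitMeasure] g) {s : ℝ}
    (hs : s ∈ Set.Icc (0 : ℝ) 1) : ∫ τ in (0 : ℝ)..s, f τ = ∫ τ in (0 : ℝ)..s, g τ := by
  refine intervalIntegral.integral_congr_ae ?_
  have h1 := (ae_restrict_iff' measurableSet_Icc).1 h
  filter_upwards [h1] with τ hτ hmem
  rw [Set.uIoc_of_le hs.1] at hmem
  exact hτ ⟨hmem.1.le, hmem.2.trans hs.2⟩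

theorem integral_unitMeasure (f : ℝ → Y) : ∫ τ, f τ ∂unitMeasure = ∫ τ in (0 : ℝ)..1, f τ := by
  rw [intervalIntegral.integral_of_le zero_le_one, integral_Icc_eq_integral_Ioc]

theorem norm_primitive_le (f : Lp Y 1 unitMeasure) {s : ℝ} (hs : s ∈ Set.Icc (0 : ℝ) 1) :
    ‖∫ τ in (0 : ℝ)..s, f τ‖ ≤ ‖f‖ := by
  rw [L1.norm_eq_integral_norm, intervalIntegral.integral_of_le hs.1]
  refine (norm_integral_le_integral_norm _).trans ?_
  refine setIntegral_mono_set (L1.integrable_coeFn f).norm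
    (Eventually.of_forall fun _ => norm_nonneg _) (Eventually.of_forall ?_)
  exact fun τ hτ => ⟨hτ.1.le, hτ.2.trans hs.2⟩

theorem continuousOn_primitive (f : Lp Y 1 unitMeasure) :
    ContinuousOn (fun s : ℝ => ∫ τ in (0 : ℝ)..s, f τ) (Set.Icc 0 1) := by
  have h := intervalIntegral.continuousOn_primitive_interval (a := (0 : ℝ)) (b := 1) (μ := volume)
    (f := f) (by rw [Set.uIcc_of_le zero_le_one]; exact L1.integrable_coeFn f)
  rwa [Set.uIcc_of_le zero_le_one] at h

/-- The Volterra operator `f ↦ (s ↦ ∫₀ˢ f)` on `L¹([0, 1], Y)`. -/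
noncomputable def volterra : Lp Y 1 unitMeasure →L[ℂ] Lp Y 1 unitMeasure :=
  LinearMap.mkContinuous
    { toFun := fun f => (memLp_unitMeasure_of_continuousOn (continuousOn_primitive f)).toLp _
      map_add' := fun f g => by
        rw [← MemLp.toLp_add]
        refine MemLp.toLp_congr _ _ ?_
        filter_upwards [ae_mem_unitInterval] with s hs
        rw [integral_congr_unitMeasure (Lp.coeFn_add f g) hs]
        exact intervalIntegral.integral_add
          (intervalIntegrable_of_unitMeasure (L1.integrable_coeFn f) hs)
          (intervalIntegrable_of_unitMeasure (L1.integrable_coeFn g) hs)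
      map_smul' := fun c f => by
        rw [RingHom.id_apply, ← MemLp.toLp_const_smul]
        refine MemLp.toLp_congr _ _ ?_
        filter_upwards [ae_mem_unitInterval] with s hs
        rw [integral_congr_unitMeasure (Lp.coeFn_smul c f) hs]
        exact intervalIntegral.integral_smul c _ } 1
    (fun f => by
      rw [one_mul]
      refine norm_le_of_ae_bound_unitMeasure (norm_nonneg f) ?_
      filter_upwards [ae_mem_unitInterval,
        (memLp_unitMeasure_of_continuousOn (continuousOn_primitive f)).coeFn_toLp] with s hs h
      simp only [LinearMap.coe_mk, AddHom.coe_mk]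
      rw [h]
      exact norm_primitive_le f hs)

theorem coeFn_volterra (f : Lp Y 1 unitMeasure) :
    volterra f =ᵐ[unitMeasure] fun s => ∫ τ in (0 : ℝ)..s, f τ :=
  (memLp_unitMeasure_of_continuousOn (continuousOn_primitive f)).coeFn_toLp

theorem norm_volterra_apply_le (f : Lp Y 1 unitMeasure) : ‖volterra f‖ ≤ ‖f‖ := by
  refine norm_le_of_ae_bound_unitMeasure (norm_nonneg f) ?_
  filter_upwards [ae_mem_unitInterval, coeFn_volterra f] with s hs h
  rw [h]
  exact norm_primitive_le f hs

/-- The constant functions in `L¹([0, 1], Y)`. -/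
noncomputable def constFun : Y →L[ℂ] Lp Y 1 unitMeasure := Lp.constL 1 unitMeasure ℂ

theorem coeFn_constFun (w : Y) : constFun w =ᵐ[unitMeasure] fun _ => w :=
  Lp.coeFn_const 1 unitMeasure w

theorem norm_constFun_le (w : Y) : ‖constFun w‖ ≤ ‖w‖ :=
  norm_le_of_ae_bound_unitMeasure (norm_nonneg w) (by
    filter_upwards [coeFn_constFun w] with s hs
    rw [hs])

/-- The graph of the operator `b⁻¹ d/ds` in `L¹([0, 1], Y)` with boundary condition
`f(1) = B f(0)`. -/
def BoundaryGraph (b B : Y →L[ℂ] Y) (f h : Lp Y 1 unitMeasure) : Prop :=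
  ∃ v : ℝ → Y, f =ᵐ[unitMeasure] v ∧
    (∀ s ∈ Set.Icc (0 : ℝ) 1, v s = v 0 + ∫ τ in (0 : ℝ)..s, b (h τ)) ∧ v 1 = B (v 0)

variable [CompleteSpace Y]

/-- The integral over `[0, 1]` as an operator `L¹([0, 1], Y) → Y`. -/
noncomputable def unitIntegral : Lp Y 1 unitMeasure →L[ℂ] Y := L1.integralCLM' ℂ

theorem unitIntegral_apply (f : Lp Y 1 unitMeasure) :
    unitIntegral f = ∫ τ in (0 : ℝ)..1, f τ := by
  rw [← integral_unitMeasure, ← L1.integral_eq_integral, L1.integral_eq' ℂ f, unitIntegral]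

theorem unitIntegral_constFun (w : Y) : unitIntegral (constFun w) = w := by
  rw [unitIntegral_apply, integral_congr_unitMeasure (coeFn_constFun w) ⟨zero_le_one, le_rfl⟩]
  simp

/-- The witness `w` is the initial value `f(0)`. This form involves bounded operators only and no
representatives. -/
theorem boundaryGraph_iff_exists {b B : Y →L[ℂ] Y} {f h : Lp Y 1 unitMeasure} :
    BoundaryGraph b B f h ↔ ∃ w, f = constFun w + volterra (b.compLpL 1 unitMeasure h) ∧
      w + unitIntegral (b.compLpL 1 unitMeasure h) = B w := by
  have hb := fun {s : ℝ} hs => integral_congr_unitMeasure (b.coeFn_compLpL h) (s := s) hs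
  constructor
  · rintro ⟨v, hfv, hv, hB⟩
    refine ⟨v 0, ?_, ?_⟩
    · refine Lp.ext ?_
      filter_upwards [hfv, ae_mem_unitInterval, Lp.coeFn_add (constFun (v 0))
        (volterra (b.compLpL 1 unitMeasure h)), coeFn_constFun (v 0), coeFn_volterra
        (b.compLpL 1 unitMeasure h)] with s h1 h2 h3 h4 h5
      rw [h1, h3, Pi.add_apply, h4, h5, hv s h2, hb h2]
    · rw [unitIntegral_apply, hb ⟨zero_le_one, le_rfl⟩, ← hv 1 ⟨zero_le_one, le_rfl⟩, hB]
  · rintro ⟨w, hf, hw⟩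
    refine ⟨fun s => w + ∫ τ in (0 : ℝ)..s, b (h τ), ?_, fun s _ => by simp, ?_⟩
    · rw [hf]
      filter_upwards [ae_mem_unitInterval, Lp.coeFn_add (constFun w)
        (volterra (b.compLpL 1 unitMeasure h)), coeFn_constFun w, coeFn_volterra
        (b.compLpL 1 unitMeasure h)] with s h2 h3 h4 h5
      rw [h3, Pi.add_apply, h4, h5, hb h2]
    · rw [unitIntegral_apply, hb ⟨zero_le_one, le_rfl⟩] at hw
      simpa using hw

/-- The function `f - volterra (b h)` is constant, so its value `w` is its own integral over `[0,
1]`. Eliminating `w` leaves equations continuous in `(f, h)`, which shows that the graph is closed.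
-/
theorem boundaryGraph_iff {b B : Y →L[ℂ] Y} {f h : Lp Y 1 unitMeasure} :
    BoundaryGraph b B f h ↔
      f - volterra (b.compLpL 1 unitMeasure h)
          = constFun (unitIntegral (f - volterra (b.compLpL 1 unitMeasure h))) ∧
        unitIntegral (f - volterra (b.compLpL 1 unitMeasure h))
            + unitIntegral (b.compLpL 1 unitMeasure h)
          = B (unitIntegral (f - volterra (b.compLpL 1 unitMeasure h))) := by
  rw [boundaryGraph_iff_exists]
  constructor
  · rintro ⟨w, hf, hw⟩
    have h1 : f - volterra (b.compLpL 1 unitMeasure h) = constFun w := by rw [hf]; abel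
    rw [h1, unitIntegral_constFun]
    exact ⟨rfl, hw⟩
  · rintro ⟨h1, h2⟩
    exact ⟨_, by rw [← h1]; abel, h2⟩

theorem isClosed_boundaryGraph (b B : Y →L[ℂ] Y) :
    IsClosed {p : Lp Y 1 unitMeasure × Lp Y 1 unitMeasure | BoundaryGraph b B p.1 p.2} := by
  simp only [boundaryGraph_iff, Set.ofPred_and]
  exact (isClosed_eq (by fun_prop) (by fun_prop)).inter (isClosed_eq (by fun_prop) (by fun_prop))

theorem BoundaryGraph.add {b B : Y →L[ℂ] Y} {f f' h h' : Lp Y 1 unitMeasure}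
    (H : BoundaryGraph b B f h) (H' : BoundaryGraph b B f' h') :
    BoundaryGraph b B (f + f') (h + h') := by
  rw [boundaryGraph_iff_exists] at *
  obtain ⟨w, h1, h2⟩ := H
  obtain ⟨w', h1', h2'⟩ := H'
  refine ⟨w + w', ?_, ?_⟩
  · rw [h1, h1']; simp only [map_add]; abel
  · simp only [map_add, ← h2, ← h2']; abel

theorem BoundaryGraph.smul {b B : Y →L[ℂ] Y} {f h : Lp Y 1 unitMeasure} (c : ℂ)
    (H : BoundaryGraph b B f h) : BoundaryGraph b B (c • f) (c • h) := by
  rw [boundaryGraph_iff_exists] at *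
  obtain ⟨w, h1, h2⟩ := H
  refine ⟨c • w, ?_, ?_⟩
  · rw [h1]; simp only [map_smul, smul_add]
  · simp only [map_smul, ← h2, smul_add]

end Volterra

/-! ### Energy estimate and classical solutions of the resolvent equation. -/

section TransportBounds

variable {Y : Type*} [NormedAddCommGroup Y] [NormedSpace ℂ Y]

/-- Bounds for the velocity operator `a`, its inverse `b` and the boundary operator `B`. The last
one says that `b` is accretive in the way a positive diagonal operator on `ℓ¹` is. -/
structure TransportBounds (a b B : Y →L[ℂ] Y) (ν m M : ℝ) : Prop where
  m_pos : 0 < m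
  M_pos : 0 < M
  nu_nonneg : 0 ≤ ν
  a_b : ∀ v, a (b v) = v
  b_a : ∀ v, b (a v) = v
  norm_a_le : ‖a‖ ≤ M
  norm_b_le : ‖b‖ ≤ m⁻¹
  norm_B_le : ‖B‖ ≤ Real.exp ν
  growth : ∀ l μ ε : ℝ, 0 ≤ μ → 0 ≤ ε → ∀ v,
    ‖v‖ + ε * ((l - μ * M) * ‖b v‖) ≤ ‖v + ε • (l • b v - μ • v)‖

namespace TransportBounds

variable {a b B : Y →L[ℂ] Y} {ν m M : ℝ}

theorem norm_le_mul_norm_b (hTB : TransportBounds a b B ν m M) (v : Y) : ‖v‖ ≤ M * ‖b v‖ := by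
  conv_lhs => rw [← hTB.a_b v]
  exact (a.le_opNorm _).trans (by gcongr; exact hTB.norm_a_le)

/-- Weighted growth estimate for solutions of `v' = l b v - b h`. -/
theorem weighted_growth (hTB : TransportBounds a b B ν m M) {v h : ℝ → Y} {l μ : ℝ} (hμ : 0 ≤ μ)
    (hv : Continuous v) (hh : Continuous h)
    (hv' : ∀ x ∈ Set.Icc (0 : ℝ) 1, HasDerivAt v (l • b (v x) - b (h x)) x) :
    ‖v 0‖ + ∫ x in (0 : ℝ)..1, Real.exp (-μ * x) * ((l - μ * M) * ‖b (v x)‖ - ‖b (h x)‖)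
      ≤ Real.exp (-μ) * ‖v 1‖ := by
  set q : ℝ → ℝ := fun x => Real.exp (-μ * x) * ((l - μ * M) * ‖b (v x)‖ - ‖b (h x)‖) with hq
  have hqc : Continuous q := by fun_prop
  set F : ℝ → Y := fun x => Real.exp (-μ * x) • v x with hF
  have hFc : Continuous F := by fun_prop
  have hF' : ∀ x ∈ Set.Icc (0 : ℝ) 1, HasDerivAt F
      ((l • b (F x) - μ • F x) - Real.exp (-μ * x) • b (h x)) x := fun x hx => by
    have h1 : HasDerivAt (fun x : ℝ => Real.exp (-μ * x)) (Real.exp (-μ * x) * (-μ * 1)) x :=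
      ((hasDerivAt_id x).const_mul (-μ)).exp
    convert! h1.smul (hv' x hx) using 1
    have h2 : b (F x) = Real.exp (-μ * x) • b (v x) := b.map_smul_of_tower _ _
    rw [h2]
    simp only [hF]
    module
  -- The norm need not be differentiable. `growth` bounds the right difference quotients of `‖F‖`
  -- from below by `q` up to a small error, and the comparison principle is applied to `-‖F‖`.
  have key := image_le_of_liminf_slope_right_le_deriv_boundary (a := 0) (b := 1)
    (f := fun x => -‖F x‖) (B := fun x => -‖v 0‖ - ∫ y in (0 : ℝ)..x, q y) (B' := fun x => -q x)
    (by fun_prop) (by simp [hF])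
    (by
      refine ContinuousOn.sub continuousOn_const ?_
      exact (intervalIntegral.continuous_primitive (fun _ _ => hqc.intervalIntegrable _ _)
        0).continuousOn)
    (fun x _ => ((hqc.integral_hasStrictDerivAt 0 x).hasDerivAt.const_sub _).hasDerivWithinAt)
    (fun x hx r hr => ?_) (x := 1) ⟨zero_le_one, le_rfl⟩
  · simp only [hF, norm_smul, Real.norm_eq_abs, Real.abs_exp, mul_one] at key
    linarith
  -- Half of the gap between `r` and `-q x` absorbs the remainder in the differentiability of `F`.
  · have hη : 0 < (r + q x) / 2 := by linarith
    have ho := (hasDerivAt_iff_isLittleO.1 (hF' x ⟨hx.1, hx.2.le⟩)).bound hη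
    have ho' : ∀ᶠ z in 𝓝[>] x, slope (fun x => -‖F x‖) x z < r := by
      filter_upwards [ho.filter_mono nhdsWithin_le_nhds, self_mem_nhdsWithin] with z hz hxz
      have hε : 0 < z - x := sub_pos.2 hxz
      rw [Real.norm_of_nonneg hε.le] at hz
      set ε := z - x with hεdef
      have g1 := hTB.growth l μ ε hμ hε.le (F x)
      have g2 : ‖b (F x)‖ = Real.exp (-μ * x) * ‖b (v x)‖ := by
        have h2 : b (F x) = Real.exp (-μ * x) • b (v x) := b.map_smul_of_tower _ _
        rw [h2, norm_smul, Real.norm_eq_abs, Real.abs_exp]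
      have g3 : ‖ε • (Real.exp (-μ * x) • b (h x))‖ = ε * (Real.exp (-μ * x) * ‖b (h x)‖) := by
        rw [norm_smul, norm_smul, Real.norm_of_nonneg hε.le, Real.norm_eq_abs, Real.abs_exp]
      have g4 : F x + ε • (l • b (F x) - μ • F x)
          = F z + ε • (Real.exp (-μ * x) • b (h x))
            - (F z - F x - ε • ((l • b (F x) - μ • F x) - Real.exp (-μ * x) • b (h x))) := by
        rw [smul_sub ε (l • b (F x) - μ • F x)]
        abel
      have g5 : ‖F x + ε • (l • b (F x) - μ • F x)‖
          ≤ ‖F z‖ + ε * (Real.exp (-μ * x) * ‖b (h x)‖) + (r + q x) / 2 * ε := by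
        rw [g4, ← g3]
        exact (norm_sub_le _ _).trans (add_le_add (norm_add_le _ _) hz)
      have g6 : ε * q x - (r + q x) / 2 * ε ≤ ‖F z‖ - ‖F x‖ := by
        rw [g2] at g1
        have : ε * q x = ε * ((l - μ * M) * (Real.exp (-μ * x) * ‖b (v x)‖))
            - ε * (Real.exp (-μ * x) * ‖b (h x)‖) := by simp only [hq]; ring
        linarith
      rw [slope_def_field, div_lt_iff₀ hε]
      nlinarith
    exact ho'.frequently

/-- With weight exponent `ν` the boundary terms drop out, because `exp (-ν) * ‖B (v 0)‖ ≤ ‖v 0‖`.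
What remains is dissipativity up to the shift `ν * M`. -/
theorem weighted_integral_le (hTB : TransportBounds a b B ν m M) {l : ℝ}
    {v h : ℝ → Y} (hv : Continuous v) (hh : Continuous h)
    (hv' : ∀ x ∈ Set.Icc (0 : ℝ) 1, HasDerivAt v (l • b (v x) - b (h x)) x)
    (hB : v 1 = B (v 0)) :
    (l - ν * M) * ∫ x in (0 : ℝ)..1, Real.exp (-ν * x) * ‖b (v x)‖
      ≤ ∫ x in (0 : ℝ)..1, Real.exp (-ν * x) * ‖b (h x)‖ := by
  have h1 := hTB.weighted_growth hTB.nu_nonneg hv hh hv'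
  have h2 : Real.exp (-ν) * ‖v 1‖ ≤ ‖v 0‖ := by
    rw [hB]
    calc Real.exp (-ν) * ‖B (v 0)‖ ≤ Real.exp (-ν) * (Real.exp ν * ‖v 0‖) := by
          gcongr; exact (B.le_opNorm _).trans (by gcongr; exact hTB.norm_B_le)
      _ = ‖v 0‖ := by rw [← mul_assoc, ← Real.exp_add]; simp
  have h3 : ∫ x in (0 : ℝ)..1, Real.exp (-ν * x) * ((l - ν * M) * ‖b (v x)‖ - ‖b (h x)‖)
      = (l - ν * M) * (∫ x in (0 : ℝ)..1, Real.exp (-ν * x) * ‖b (v x)‖)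
        - ∫ x in (0 : ℝ)..1, Real.exp (-ν * x) * ‖b (h x)‖ := by
    rw [← intervalIntegral.integral_const_mul, ← intervalIntegral.integral_sub]
    · congr 1; ext x; ring
    · exact Continuous.intervalIntegrable (by fun_prop) _ _
    · exact Continuous.intervalIntegrable (by fun_prop) _ _
  linarith

variable [CompleteSpace Y]

theorem hasDerivAt_opExp_smul (b : Y →L[ℂ] Y) (l : ℝ) (v : Y) (x : ℝ) :
    HasDerivAt (fun x => opExp ((l : ℂ) • b) x v) (l • b (opExp ((l : ℂ) • b) x v)) x := by
  have h := hasDerivAt_opExp_apply ((l : ℂ) • b) v x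
  have h1 : opExp ((l : ℂ) • b) x (((l : ℂ) • b) v) = l • b (opExp ((l : ℂ) • b) x v) := by
    have := congrArg (fun L : Y →L[ℂ] Y => L v)
      ((Commute.refl ((l : ℂ) • b)).opExp_right x).eq
    simp only [mul_apply_eq_comp] at this
    rw [← this, _root_.smul_apply, Complex.coe_smul]
  rwa [h1] at h

theorem opExp_neg_apply_opExp (Z : Y →L[ℂ] Y) (x : ℝ) (v : Y) :
    opExp Z x (opExp Z (-x) v) = v := by
  rw [← mul_apply_eq_comp, ← opExp_add, add_neg_cancel, opExp_zero, one_apply_eq_self]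

/-- The weight exponent `μ = l / M` makes `l - μ * M` vanish, so for the homogeneous equation
`weighted_growth` compares the endpoint values alone. -/
theorem norm_opExp_neg_one_le (hTB : TransportBounds a b B ν m M) {l : ℝ} (hl : 0 ≤ l) :
    ‖opExp ((l : ℂ) • b) (-1)‖ ≤ Real.exp (-(l / M)) := by
  have hM := hTB.M_pos
  refine ContinuousLinearMap.opNorm_le_bound _ (Real.exp_pos _).le fun w => ?_
  have h := hTB.weighted_growth (l := l) (μ := l / M) (h := fun _ => 0)
    (v := fun x => opExp ((l : ℂ) • b) x (opExp ((l : ℂ) • b) (-1) w)) (by positivity)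
    (continuous_opExp_apply _ _) continuous_const
    (fun x _ => by simpa using hasDerivAt_opExp_smul b l _ x)
  have h1 : l - l / M * M = 0 := by field_simp; ring
  simp only [h1, opExp_zero, one_apply_eq_self, opExp_neg_apply_opExp] at h
  simpa using h

/-- This is the boundary condition for the solution given by variation of constants. A Neumann
series solves it, as `‖exp (-l b) B‖ ≤ exp (ν - l / M) < 1`. -/
theorem exists_boundary_fixed_point (hTB : TransportBounds a b B ν m M) {l : ℝ} (hl : ν * M < l)
    (w : Y) : ∃ v₀, v₀ - opExp ((l : ℂ) • b) (-1) (B v₀) = w := by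
  have hM := hTB.M_pos
  have hν := hTB.nu_nonneg
  have hl0 : 0 ≤ l := le_trans (by positivity) hl.le
  have h1 : ‖opExp ((l : ℂ) • b) (-1) * B‖ < 1 := by
    refine (norm_mul_le _ _).trans_lt ?_
    calc ‖opExp ((l : ℂ) • b) (-1)‖ * ‖B‖ ≤ Real.exp (-(l / M)) * Real.exp ν := by
          gcongr
          · exact hTB.norm_opExp_neg_one_le hl0
          · exact hTB.norm_B_le
      _ = Real.exp (-(l / M) + ν) := (Real.exp_add _ _).symm
      _ < 1 := by
          rw [Real.exp_lt_one_iff]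
          have : ν < l / M := by rwa [lt_div_iff₀ hM]
          linarith
  obtain ⟨U, hU⟩ := isUnit_one_sub_of_norm_lt_one h1
  refine ⟨(↑U⁻¹ : Y →L[ℂ] Y) w, ?_⟩
  have h2 : (U : Y →L[ℂ] Y) ((↑U⁻¹ : Y →L[ℂ] Y) w) = w := by
    rw [← mul_apply_eq_comp, Units.mul_inv, one_apply_eq_self]
  rw [hU] at h2
  simpa using h2

/-- The resolvent equation has a classical solution when the right hand side is continuous. -/
theorem exists_classical_solution (hTB : TransportBounds a b B ν m M) {l : ℝ} (hl : ν * M < l)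
    {h : ℝ → Y} (hh : Continuous h) :
    ∃ v : ℝ → Y, Continuous v ∧ (∀ x, HasDerivAt v (l • b (v x) - b (h x)) x) ∧
      v 1 = B (v 0) := by
  set Z : Y →L[ℂ] Y := (l : ℂ) • b with hZ
  have hop : Continuous fun x : ℝ => (opExp Z x).restrictScalars ℝ :=
    continuous_iff_continuousAt.2 fun x => (hasDerivAt_opExp Z x).continuousAt
  have hk : Continuous fun y : ℝ => opExp Z (-y) (b (h y)) :=
    (hop.comp continuous_neg).clm_apply (b.continuous.comp hh)
  -- Variation of constants: the solution is `exp (x Z) (v₀ - I x)`, and `v₀` is fixed by the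
  -- boundary condition.
  set I : ℝ → Y := fun x => ∫ y in (0 : ℝ)..x, opExp Z (-y) (b (h y)) with hI
  have hI' : ∀ x, HasDerivAt I (opExp Z (-x) (b (h x))) x := fun x =>
    (hk.integral_hasStrictDerivAt 0 x).hasDerivAt
  obtain ⟨v₀, hv₀⟩ := hTB.exists_boundary_fixed_point hl (I 1)
  have hd : ∀ x, HasDerivAt (fun x => opExp Z x (v₀ - I x))
      (l • b (opExp Z x (v₀ - I x)) - b (h x)) x := fun x => by
    have h1 := (hasDerivAt_opExp Z x).clm_apply ((hI' x).const_sub v₀)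
    convert! h1 using 1
    have h2 : opExp Z x (Z (v₀ - I x)) = l • b (opExp Z x (v₀ - I x)) :=
      (hasDerivAt_opExp_apply Z _ x).unique (hasDerivAt_opExp_smul b l _ x)
    simp only [ContinuousLinearMap.coe_restrictScalars', mul_apply_eq_comp]
    rw [h2, map_neg, opExp_neg_apply_opExp, sub_eq_add_neg]
  refine ⟨fun x => opExp Z x (v₀ - I x), continuous_iff_continuousAt.2 fun x =>
    (hd x).continuousAt, hd, ?_⟩
  have hI0 : I 0 = 0 := by simp [hI]
  have h3 : v₀ - I 1 = opExp Z (-1) (B v₀) := by rw [← hv₀]; abel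
  simp only [hI0, h3, opExp_zero, one_apply_eq_self, sub_zero, opExp_neg_apply_opExp]

end TransportBounds

end TransportBounds

/-! ### The weighted norm and its equivalence with the `L¹`-norm. -/

section WeightedNorm

variable {Y : Type*} [NormedAddCommGroup Y] [NormedSpace ℂ Y]

/-- The weighted norm in which the transport operator is quasi-dissipative. -/
noncomputable def weightedNorm (b : Y →L[ℂ] Y) (ν : ℝ) (f : Lp Y 1 unitMeasure) : ℝ :=
  ∫ x, Real.exp (-ν * x) * ‖b (f x)‖ ∂unitMeasure

variable {a b B : Y →L[ℂ] Y} {ν m M : ℝ}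

theorem weightedNorm_congr {f : Lp Y 1 unitMeasure} {v : ℝ → Y} (h : f =ᵐ[unitMeasure] v) :
    weightedNorm b ν f = ∫ x in (0 : ℝ)..1, Real.exp (-ν * x) * ‖b (v x)‖ := by
  rw [weightedNorm, intervalIntegral.integral_of_le zero_le_one, ← integral_Icc_eq_integral_Ioc]
  refine integral_congr_ae ?_
  filter_upwards [h] with x hx
  rw [hx]

theorem ae_exp_le_one (hν : 0 ≤ ν) : ∀ᵐ x ∂unitMeasure, Real.exp (-ν * x) ≤ 1 := by
  filter_upwards [ae_mem_unitInterval] with x hx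
  rw [Real.exp_le_one_iff]
  nlinarith [hx.1]

theorem integrable_weightedNorm (hν : 0 ≤ ν) (f : Lp Y 1 unitMeasure) :
    Integrable (fun x => Real.exp (-ν * x) * ‖b (f x)‖) unitMeasure := by
  have h1 : Integrable (fun x => b (f x)) unitMeasure := b.integrable_comp (L1.integrable_coeFn f)
  refine Integrable.mono' h1.norm ?_ ?_
  · exact (Continuous.aestronglyMeasurable (by fun_prop)).mul h1.norm.aestronglyMeasurable
  · filter_upwards [ae_exp_le_one hν] with x hx
    rw [norm_mul, norm_norm, Real.norm_eq_abs, Real.abs_exp]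
    exact mul_le_of_le_one_left (norm_nonneg _) hx

theorem weightedNorm_add_le (hν : 0 ≤ ν) (f g : Lp Y 1 unitMeasure) :
    weightedNorm b ν (f + g) ≤ weightedNorm b ν f + weightedNorm b ν g := by
  rw [weightedNorm, weightedNorm, weightedNorm, ← integral_add (integrable_weightedNorm hν f)
    (integrable_weightedNorm hν g)]
  refine integral_mono_ae (integrable_weightedNorm hν _)
    ((integrable_weightedNorm hν f).add (integrable_weightedNorm hν g)) ?_
  filter_upwards [Lp.coeFn_add f g] with x hx
  rw [hx, Pi.add_apply, map_add, ← mul_add]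
  gcongr
  exact norm_add_le _ _

theorem weightedNorm_le (hν : 0 ≤ ν) (f : Lp Y 1 unitMeasure) :
    weightedNorm b ν f ≤ ‖b‖ * ‖f‖ := by
  rw [L1.norm_eq_integral_norm, weightedNorm, ← integral_const_mul]
  refine integral_mono_ae (integrable_weightedNorm hν _)
    ((L1.integrable_coeFn f).norm.const_mul _) ?_
  filter_upwards [ae_exp_le_one hν] with x hx
  exact (mul_le_of_le_one_left (norm_nonneg _) hx).trans (b.le_opNorm _)

theorem continuous_weightedNorm (hν : 0 ≤ ν) : Continuous (weightedNorm b ν) := by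
  have h : ∀ f g, weightedNorm b ν f - weightedNorm b ν g ≤ ‖b‖ * dist f g := fun f g => by
    have h1 := weightedNorm_add_le (b := b) hν (f - g) g
    rw [sub_add_cancel] at h1
    have h2 := weightedNorm_le (b := b) hν (f - g)
    rw [dist_eq_norm]
    linarith
  refine (LipschitzWith.of_dist_le_mul (K := ‖b‖₊) fun f g => ?_).continuous
  rw [Real.dist_eq, abs_le, coe_nnnorm]
  refine ⟨?_, h f g⟩
  have := h g f
  rw [dist_comm] at this
  linarith

theorem TransportBounds.norm_le_weightedNorm (hTB : TransportBounds a b B ν m M)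
    (f : Lp Y 1 unitMeasure) : ‖f‖ ≤ Real.exp ν * M * weightedNorm b ν f := by
  rw [L1.norm_eq_integral_norm, weightedNorm, ← integral_const_mul]
  refine integral_mono_ae (L1.integrable_coeFn f).norm
    ((integrable_weightedNorm hTB.nu_nonneg _).const_mul _) ?_
  filter_upwards [ae_mem_unitInterval] with x hx
  have hM := hTB.M_pos
  have h1 : 1 ≤ Real.exp ν * Real.exp (-ν * x) := by
    rw [← Real.exp_add, Real.one_le_exp_iff]
    nlinarith [hTB.nu_nonneg, hx.2]
  calc ‖f x‖ ≤ M * ‖b (f x)‖ := hTB.norm_le_mul_norm_b _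
    _ ≤ (Real.exp ν * Real.exp (-ν * x)) * (M * ‖b (f x)‖) :=
        le_mul_of_one_le_left (by positivity) h1
    _ = _ := by ring

theorem TransportBounds.weightedNorm_le (hTB : TransportBounds a b B ν m M)
    (f : Lp Y 1 unitMeasure) : weightedNorm b ν f ≤ m⁻¹ * ‖f‖ :=
  (_root_.weightedNorm_le hTB.nu_nonneg f).trans (by gcongr; exact hTB.norm_b_le)

theorem TransportBounds.norm_le_of_weightedNorm_le (hTB : TransportBounds a b B ν m M) {D : ℝ} (hD : 0 ≤ D)
    {f h : Lp Y 1 unitMeasure} (hfh : weightedNorm b ν f ≤ D * weightedNorm b ν h) :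
    ‖f‖ ≤ Real.exp ν * M * m⁻¹ * D * ‖h‖ := by
  have hM := hTB.M_pos
  calc ‖f‖ ≤ Real.exp ν * M * weightedNorm b ν f := hTB.norm_le_weightedNorm f
    _ ≤ Real.exp ν * M * (D * (m⁻¹ * ‖h‖)) := by
        gcongr; exact hfh.trans (by gcongr; exact hTB.weightedNorm_le h)
    _ = _ := by ring

end WeightedNorm

/-! ### Resolvents and Hille–Yosida estimates for the transport operator. -/

section Resolvent

variable {Y : Type*} [NormedAddCommGroup Y] [NormedSpace ℂ Y] [CompleteSpace Y]
  {a b B : Y →L[ℂ] Y} {ν m M : ℝ}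

theorem boundaryGraph_of_hasDerivAt {f h : Lp Y 1 unitMeasure} {v k : ℝ → Y}
    (hf : f =ᵐ[unitMeasure] v) (hk : Continuous fun x => b (k x)) (hh : h =ᵐ[unitMeasure] k)
    (hv : ∀ x, HasDerivAt v (b (k x)) x) (hB : v 1 = B (v 0)) : BoundaryGraph b B f h := by
  refine ⟨v, hf, fun s hs => ?_, hB⟩
  have h1 : (fun τ => b (h τ)) =ᵐ[unitMeasure] fun τ => b (k τ) := by
    filter_upwards [hh] with τ hτ
    rw [hτ]
  rw [integral_congr_unitMeasure h1 hs, intervalIntegral.integral_eq_sub_of_hasDerivAt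
    (fun x _ => hv x) (hk.intervalIntegrable _ _)]
  abel

namespace TransportBounds

theorem exists_solution_of_continuous (hTB : TransportBounds a b B ν m M) {l : ℝ}
    (hl : ν * M < l) {h : Lp Y 1 unitMeasure} {k : ℝ → Y} (hk : Continuous k)
    (hh : h =ᵐ[unitMeasure] k) :
    ∃ f, BoundaryGraph b B f ((l : ℂ) • f - h) ∧
      (l - ν * M) * weightedNorm b ν f ≤ weightedNorm b ν h := by
  obtain ⟨v, hv, hv', hB⟩ := hTB.exists_classical_solution hl hk
  have hmem : MemLp v 1 unitMeasure := memLp_unitMeasure_of_continuousOn hv.continuousOn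
  refine ⟨hmem.toLp v, ?_, ?_⟩
  · refine boundaryGraph_of_hasDerivAt (v := v) (k := fun x => (l : ℂ) • v x - k x)
      hmem.coeFn_toLp (by fun_prop) ?_ (fun x => ?_) hB
    · filter_upwards [Lp.coeFn_sub ((l : ℂ) • hmem.toLp v) h, Lp.coeFn_smul (l : ℂ) (hmem.toLp v),
        hmem.coeFn_toLp, hh] with x h1 h2 h3 h4
      rw [h1, Pi.sub_apply, h2, Pi.smul_apply, h3, h4]
    · have := hv' x
      rwa [← Complex.coe_smul, ← map_smul, ← map_sub] at this
  · rw [weightedNorm_congr hmem.coeFn_toLp, weightedNorm_congr hh]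
    exact hTB.weighted_integral_le hv hk (fun x _ => hv' x) hB

/-- A weak solution of the homogeneous equation is continuous, hence by its integral equation
continuously differentiable, and the energy estimate with zero data applies. -/
theorem eq_zero_of_boundaryGraph (hTB : TransportBounds a b B ν m M) {l : ℝ} (hl : ν * M < l)
    {f : Lp Y 1 unitMeasure} (hf : BoundaryGraph b B f ((l : ℂ) • f)) : f = 0 := by
  obtain ⟨v, hfv, hv, hB⟩ := hf
  have h1 : (fun τ => b (((l : ℂ) • f : Lp Y 1 unitMeasure) τ)) =ᵐ[unitMeasure]
      fun τ => l • b (v τ) := by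
    filter_upwards [Lp.coeFn_smul (l : ℂ) f, hfv] with τ h2 h3
    rw [h2, Pi.smul_apply, h3, map_smul, Complex.coe_smul]
  have h2 : (fun τ => b (((l : ℂ) • f : Lp Y 1 unitMeasure) τ)) =ᵐ[unitMeasure]
      (b.compLpL 1 unitMeasure ((l : ℂ) • f)) := (b.coeFn_compLpL _).symm
  have hvc : ContinuousOn v (Set.Icc 0 1) := by
    refine ((continuousOn_primitive (b.compLpL 1 unitMeasure ((l : ℂ) • f))).const_add
      (v 0)).congr fun s hs => ?_
    rw [hv s hs, integral_congr_unitMeasure h2 hs]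
  -- The representative `v` is arbitrary outside `[0, 1]`; extending it constantly gives a globally
  -- continuous integrand, and its primitive `g` is a classical solution equal to `v` on `[0, 1]`.
  set w : ℝ → Y := Set.IccExtend (zero_le_one' ℝ) ((Set.Icc (0 : ℝ) 1).domRestrict v) with hw
  have hwc : Continuous w := (continuousOn_iff_continuous_domRestrict.1 hvc).Icc_extend'
  have hwv : ∀ x ∈ Set.Icc (0 : ℝ) 1, w x = v x := fun x hx => Set.IccExtend_of_mem _ _ hx
  set g : ℝ → Y := fun s => v 0 + ∫ τ in (0 : ℝ)..s, l • b (w τ) with hg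
  have hint : Continuous fun τ => l • b (w τ) := by fun_prop
  have hg' : ∀ x, HasDerivAt g (l • b (w x)) x := fun x =>
    (hint.integral_hasStrictDerivAt 0 x).hasDerivAt.const_add _
  have hgv : ∀ x ∈ Set.Icc (0 : ℝ) 1, g x = v x := fun x hx => by
    rw [hv x hx, integral_congr_unitMeasure h1 hx, hg]
    simp only
    congr 1
    refine integral_congr_unitMeasure ?_ hx
    filter_upwards [ae_mem_unitInterval] with τ hτ
    rw [hwv τ hτ]
  have h0 : (0 : ℝ) ∈ Set.Icc (0 : ℝ) 1 := ⟨le_rfl, zero_le_one⟩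
  have h1' : (1 : ℝ) ∈ Set.Icc (0 : ℝ) 1 := ⟨zero_le_one, le_rfl⟩
  have hest := hTB.weighted_integral_le (l := l) (v := g) (h := fun _ => 0)
    (continuous_iff_continuousAt.2 fun x => (hg' x).continuousAt) continuous_const
    (fun x hx => by
      have := hg' x
      rw [hwv x hx, ← hgv x hx] at this
      simpa using this)
    (by rw [hgv 1 h1', hgv 0 h0, hB])
  have hfg : f =ᵐ[unitMeasure] g := by
    filter_upwards [hfv, ae_mem_unitInterval] with x hx hx'
    rw [hx, hgv x hx']
  rw [← weightedNorm_congr hfg] at hest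
  have hN : weightedNorm b ν f ≤ 0 := by
    by_contra! hpos
    have : 0 < (l - ν * M) * weightedNorm b ν f := mul_pos (by linarith) hpos
    simp at hest
    linarith
  have hM := hTB.M_pos
  have := hTB.norm_le_weightedNorm f
  refine norm_le_zero_iff.1 (this.trans ?_)
  exact mul_nonpos_of_nonneg_of_nonpos (by positivity) hN

theorem boundaryGraph_unique (hTB : TransportBounds a b B ν m M) {l : ℝ} (hl : ν * M < l)
    {f f' h : Lp Y 1 unitMeasure} (hf : BoundaryGraph b B f ((l : ℂ) • f - h))
    (hf' : BoundaryGraph b B f' ((l : ℂ) • f' - h)) : f = f' := by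
  refine sub_eq_zero.1 (hTB.eq_zero_of_boundaryGraph hl ?_)
  convert! hf.add (hf'.smul (-1)) using 1
  · rw [neg_one_smul, sub_eq_add_neg]
  · rw [smul_sub]; simp only [neg_smul, one_smul]; abel

theorem weightedNorm_solution_le (hTB : TransportBounds a b B ν m M) {l : ℝ}
    (hl : ν * M < l) {f h : Lp Y 1 unitMeasure} (hf : BoundaryGraph b B f ((l : ℂ) • f - h))
    {k : ℝ → Y} (hk : Continuous k) (hh : h =ᵐ[unitMeasure] k) :
    (l - ν * M) * weightedNorm b ν f ≤ weightedNorm b ν h := by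
  obtain ⟨f', hf', h1⟩ := hTB.exists_solution_of_continuous hl hk hh
  rwa [hTB.boundaryGraph_unique hl hf hf']

/-- Continuous data are dense. The estimate makes the corresponding solutions a Cauchy sequence, and
closedness of the graph identifies the limit. -/
theorem exists_solution (hTB : TransportBounds a b B ν m M) {l : ℝ} (hl : ν * M < l)
    (h : Lp Y 1 unitMeasure) :
    ∃ f, BoundaryGraph b B f ((l : ℂ) • f - h) ∧
      (l - ν * M) * weightedNorm b ν f ≤ weightedNorm b ν h := by
  have hd : 0 < l - ν * M := by linarith
  have hdense : Dense {h : Lp Y 1 unitMeasure | ∃ k : ℝ → Y, h =ᵐ[unitMeasure] k ∧ Continuous k} :=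
    (Lp.dense_hasCompactSupport_contDiff (μ := unitMeasure) (F := Y) ENNReal.one_ne_top).mono (by
      rintro h ⟨k, h1, -, h2⟩
      exact ⟨k, h1, h2.continuous⟩)
  obtain ⟨hs, hmem, hlim⟩ := mem_closure_iff_seq_limit.1 (hdense h)
  choose k hk hkc using hmem
  choose f hf hfN using fun n => hTB.exists_solution_of_continuous hl (hkc n) (hk n)
  set K : ℝ := Real.exp ν * M * m⁻¹ * (l - ν * M)⁻¹ with hK
  have hM := hTB.M_pos
  have hm := hTB.m_pos
  have hLip : ∀ i j, dist (f i) (f j) ≤ K * dist (hs i) (hs j) := fun i j => by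
    have h1 : BoundaryGraph b B (f i - f j) ((l : ℂ) • (f i - f j) - (hs i - hs j)) := by
      convert! (hf i).add ((hf j).smul (-1)) using 1
      · rw [neg_one_smul, sub_eq_add_neg]
      · rw [smul_sub]; simp only [neg_smul, one_smul]; abel
    have h2 := hTB.weightedNorm_solution_le hl h1 ((hkc i).sub (hkc j))
      ((Lp.coeFn_sub _ _).trans ((hk i).sub (hk j)))
    rw [dist_eq_norm, dist_eq_norm]
    refine hTB.norm_le_of_weightedNorm_le (inv_nonneg.2 hd.le) ?_
    rwa [inv_mul_eq_div, le_div_iff₀' hd]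
  have hcau : CauchySeq f := by
    rw [cauchySeq_iff_tendsto_dist_atTop_0]
    have h1 := (cauchySeq_iff_tendsto_dist_atTop_0.1 hlim.cauchySeq).const_mul K
    rw [mul_zero] at h1
    exact squeeze_zero (fun _ => dist_nonneg) (fun n => hLip n.1 n.2) h1
  obtain ⟨g, hg⟩ := cauchySeq_tendsto_of_complete hcau
  refine ⟨g, ?_, ?_⟩
  · exact (isClosed_boundaryGraph b B).mem_of_tendsto
      (hg.prodMk_nhds ((hg.const_smul (l : ℂ)).sub hlim)) (Eventually.of_forall hf)
  · have hc := continuous_weightedNorm (b := b) hTB.nu_nonneg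
    exact le_of_tendsto_of_tendsto' (((hc.tendsto g).comp hg).const_mul _)
      ((hc.tendsto h).comp hlim) hfN

theorem exists_resolvent (hTB : TransportBounds a b B ν m M) {l : ℝ} (hl : ν * M < l) :
    ∃ R : Lp Y 1 unitMeasure →L[ℂ] Lp Y 1 unitMeasure, ∀ h,
      BoundaryGraph b B (R h) ((l : ℂ) • R h - h) ∧
        weightedNorm b ν (R h) ≤ (l - ν * M)⁻¹ * weightedNorm b ν h := by
  have hd : 0 < l - ν * M := by linarith
  choose S hS hSN using hTB.exists_solution hl
  have hSN' : ∀ h, weightedNorm b ν (S h) ≤ (l - ν * M)⁻¹ * weightedNorm b ν h := fun h => by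
    rw [inv_mul_eq_div, le_div_iff₀' hd]
    exact hSN h
  refine ⟨LinearMap.mkContinuous
    { toFun := S
      map_add' := fun f g => hTB.boundaryGraph_unique hl (hS _) ?_
      map_smul' := fun c f => hTB.boundaryGraph_unique hl (hS _) ?_ }
    (Real.exp ν * M * m⁻¹ * (l - ν * M)⁻¹)
    (fun h => hTB.norm_le_of_weightedNorm_le (inv_nonneg.2 hd.le) (hSN' h)),
    fun h => ⟨hS h, hSN' h⟩⟩
  · convert! (hS f).add (hS g) using 1
    rw [smul_add]; abel
  · convert! (hS f).smul c using 1
    rw [RingHom.id_apply, smul_sub, smul_comm]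

/-- The domain of the transport operator is dense. -/
theorem dense_domain (hTB : TransportBounds a b B ν m M) :
    Dense {f | ∃ h, BoundaryGraph b B f h} := by
  have hdense := Lp.dense_hasCompactSupport_contDiff (μ := unitMeasure) (F := Y) ENNReal.one_ne_top
  refine dense_iff_closure_eq.2 (Set.eq_univ_of_univ_subset ?_)
  rw [← hdense.closure_eq]
  refine closure_minimal ?_ isClosed_closure
  rintro f ⟨g, hfg, -, hg⟩
  set w : Y := B (g 0) - g 1 with hw
  have hgd : Differentiable ℝ g := hg.differentiable (by simp)
  have hgc : Continuous (deriv g) := hg.continuous_deriv (by exact_mod_cast le_top)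
  -- The term `x ^ (n + 1) • w` leaves the value at `0` unchanged and repairs the boundary defect
  -- `w` at `1`, at an `L¹` cost of `‖w‖ / (n + 2)`.
  set v : ℕ → ℝ → Y := fun n x => g x + x ^ (n + 1) • w with hv
  have hv' : ∀ n x, HasDerivAt (v n) (deriv g x + (((n + 1 : ℕ) : ℝ) * x ^ n) • w) x := fun n x =>
    (hgd x).hasDerivAt.add ((hasDerivAt_pow (n + 1) x).smul_const w)
  have hvc : ∀ n, Continuous (v n) := fun n =>
    continuous_iff_continuousAt.2 fun x => (hv' n x).continuousAt
  have hmem : ∀ n, MemLp (v n) 1 unitMeasure := fun n =>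
    memLp_unitMeasure_of_continuousOn (hvc n).continuousOn
  set k : ℕ → ℝ → Y := fun n x => a (deriv g x + (((n + 1 : ℕ) : ℝ) * x ^ n) • w) with hk
  have hkmem : ∀ n, MemLp (k n) 1 unitMeasure := fun n =>
    memLp_unitMeasure_of_continuousOn (Continuous.continuousOn (by fun_prop))
  have hbk : ∀ n x, b (k n x) = deriv g x + (((n + 1 : ℕ) : ℝ) * x ^ n) • w := fun n x =>
    hTB.b_a _
  refine mem_closure_iff_seq_limit.2 ⟨fun n => (hmem n).toLp (v n), fun n => ?_, ?_⟩
  · refine ⟨(hkmem n).toLp (k n), boundaryGraph_of_hasDerivAt (hmem n).coeFn_toLp ?_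
      (hkmem n).coeFn_toLp (fun x => ?_) ?_⟩
    · fun_prop
    · rw [hbk]; exact hv' n x
    · simp [hv, hw]
  · rw [tendsto_iff_norm_sub_tendsto_zero]
    have hlim : Tendsto (fun n : ℕ => 1 / ((n : ℝ) + 1) * ‖w‖) atTop (𝓝 0) := by
      simpa using tendsto_one_div_add_atTop_nhds_zero_nat.mul_const ‖w‖
    refine squeeze_zero (fun _ => norm_nonneg _) (fun n => ?_) hlim
    have h1 : ((hmem n).toLp (v n) - f : Lp Y 1 unitMeasure) =ᵐ[unitMeasure]
        fun x => x ^ (n + 1) • w := by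
      filter_upwards [Lp.coeFn_sub ((hmem n).toLp (v n)) f, (hmem n).coeFn_toLp, hfg]
        with x h2 h3 h4
      rw [h2, Pi.sub_apply, h3, h4]
      simp [hv]
    rw [L1.norm_eq_integral_norm]
    have h5 : ∫ x, ‖((hmem n).toLp (v n) - f : Lp Y 1 unitMeasure) x‖ ∂unitMeasure
        = ∫ x in (0 : ℝ)..1, x ^ (n + 1) * ‖w‖ := by
      rw [intervalIntegral.integral_of_le zero_le_one, ← integral_Icc_eq_integral_Ioc]
      refine integral_congr_ae ?_
      filter_upwards [h1, ae_mem_unitInterval] with x h6 h7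
      rw [h6, norm_smul, norm_pow, Real.norm_of_nonneg h7.1]
    rw [h5, intervalIntegral.integral_mul_const, integral_pow]
    refine mul_le_mul_of_nonneg_right ?_ (norm_nonneg w)
    rw [one_pow, zero_pow (by omega), sub_zero]
    push_cast
    exact one_div_le_one_div_of_le (by positivity) (by linarith)

/-- The transport operator satisfies the Hille–Yosida conditions. -/
theorem exists_hilleYosida (hTB : TransportBounds a b B ν m M) :
    ∃ R, HilleYosida (BoundaryGraph b B) R (ν * M) (Real.exp ν * M * m⁻¹) := by
  have hM := hTB.M_pos
  have hν := hTB.nu_nonneg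
  have hm := hTB.m_pos
  have h1 : ∀ l : ℝ, ∃ R : Lp Y 1 unitMeasure →L[ℂ] Lp Y 1 unitMeasure, ν * M < l → ∀ h,
      BoundaryGraph b B (R h) ((l : ℂ) • R h - h) ∧
        weightedNorm b ν (R h) ≤ (l - ν * M)⁻¹ * weightedNorm b ν h := fun l => by
    by_cases hl : ν * M < l
    · obtain ⟨R, hR⟩ := hTB.exists_resolvent hl
      exact ⟨R, fun _ => hR⟩
    -- The value for `l ≤ ν * M` is irrelevant: `HilleYosida` constrains only larger `l`.
    · exact ⟨0, fun h => absurd h hl⟩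
  choose R hR using h1
  refine ⟨R, by positivity, fun l hl f g => ⟨fun hfg => ?_, fun hfg => ?_⟩, fun l hl k => ?_,
    hTB.dense_domain⟩
  · refine hTB.boundaryGraph_unique hl (hR l hl _).1 ?_
    simpa using hfg
  · have := (hR l hl ((l : ℂ) • f - g)).1
    rw [hfg] at this
    simpa using this
  · have hd : 0 < l - ν * M := by linarith
    -- In the weighted norm the resolvent bound has constant `1`, so it can be iterated; the
    -- equivalence constant of the norms then enters only once.
    have hN : ∀ h, weightedNorm b ν ((R l ^ k) h) ≤ (l - ν * M)⁻¹ ^ k * weightedNorm b ν h := by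
      intro h
      induction k with
      | zero => simp
      | succ k ih =>
        rw [pow_succ', mul_apply_eq_comp, pow_succ', mul_assoc]
        exact (hR l hl _).2.trans (by gcongr)
    refine ContinuousLinearMap.opNorm_le_bound _ (by positivity) fun h => ?_
    exact hTB.norm_le_of_weightedNorm_le (by positivity) (hN h)

end TransportBounds

end Resolvent

/-! ### Resolvent convergence under compression of the boundary operator. -/

section ResolventConvergence

variable {Y Z W : Type*} [NormedAddCommGroup Y] [NormedSpace ℂ Y] [NormedAddCommGroup Z]
  [NormedSpace ℂ Z] [NormedAddCommGroup W] [NormedSpace ℂ W]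

theorem compLpL_compLpL (L : Z →L[ℂ] W) (L' : Y →L[ℂ] Z) (f : Lp Y 1 unitMeasure) :
    L.compLpL 1 unitMeasure (L'.compLpL 1 unitMeasure f) = (L ∘L L').compLpL 1 unitMeasure f := by
  refine Lp.ext ?_
  filter_upwards [L.coeFn_compLpL (L'.compLpL 1 unitMeasure f), L'.coeFn_compLpL f,
    (L ∘L L').coeFn_compLpL f] with s h1 h2 h3
  rw [h1, h2, h3]
  rfl

theorem compLpL_id (f : Lp Y 1 unitMeasure) :
    (ContinuousLinearMap.id ℂ Y).compLpL 1 unitMeasure f = f := by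
  refine Lp.ext ?_
  filter_upwards [(ContinuousLinearMap.id ℂ Y).coeFn_compLpL f] with s h1
  rw [h1]
  rfl

theorem compLpL_constFun (L : Y →L[ℂ] Z) (w : Y) :
    L.compLpL 1 unitMeasure (constFun w) = constFun (L w) := by
  refine Lp.ext ?_
  filter_upwards [L.coeFn_compLpL (constFun w), coeFn_constFun w, coeFn_constFun (L w)]
    with s h1 h2 h3
  rw [h1, h2, h3]

theorem tendsto_compLpL_apply {L : ℕ → Y →L[ℂ] Y} (hL : ∀ n, ‖L n‖ ≤ 1)
    (h : ∀ v, Tendsto (fun n => L n v) atTop (𝓝 v)) (f : Lp Y 1 unitMeasure) :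
    Tendsto (fun n => (L n).compLpL 1 unitMeasure f) atTop (𝓝 f) := by
  rw [tendsto_iff_norm_sub_tendsto_zero]
  have h1 : ∀ n, ‖(L n).compLpL 1 unitMeasure f - f‖ = ∫ s, ‖L n (f s) - f s‖ ∂unitMeasure := by
    intro n
    rw [L1.norm_eq_integral_norm]
    refine integral_congr_ae ?_
    filter_upwards [Lp.coeFn_sub ((L n).compLpL 1 unitMeasure f) f, (L n).coeFn_compLpL f]
      with s h2 h3
    rw [h2, Pi.sub_apply, h3]
  simp only [h1]
  have hf := L1.integrable_coeFn f
  have h4 := tendsto_integral_of_dominated_convergence (μ := unitMeasure)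
    (F := fun n s => ‖L n (f s) - f s‖) (f := fun _ => (0 : ℝ)) (fun s => ‖f s‖ + ‖f s‖)
    (fun n => (((L n).integrable_comp hf).sub hf).norm.aestronglyMeasurable)
    (hf.norm.add hf.norm)
    (fun n => Eventually.of_forall fun s => by
      rw [norm_norm]
      exact (norm_sub_le _ _).trans
        (add_le_add (norm_apply_le_of_norm_le_one (hL n) _) le_rfl))
    (Eventually.of_forall fun s => by
      simpa using ((h (f s)).sub_const (f s)).norm)
  simpa using h4

variable [CompleteSpace Y] [CompleteSpace Z]

theorem compLpL_volterra (L : Y →L[ℂ] Z) (f : Lp Y 1 unitMeasure) :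
    L.compLpL 1 unitMeasure (volterra f) = volterra (L.compLpL 1 unitMeasure f) := by
  refine Lp.ext ?_
  filter_upwards [L.coeFn_compLpL (volterra f), coeFn_volterra f,
    coeFn_volterra (L.compLpL 1 unitMeasure f), ae_mem_unitInterval] with s h1 h2 h3 hs
  rw [h1, h2, h3, integral_congr_unitMeasure (L.coeFn_compLpL f) hs]
  exact (L.intervalIntegral_comp_comm
    (intervalIntegrable_of_unitMeasure (L1.integrable_coeFn f) hs)).symm

theorem unitIntegral_compLpL (L : Y →L[ℂ] Z) (f : Lp Y 1 unitMeasure) :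
    unitIntegral (L.compLpL 1 unitMeasure f) = L (unitIntegral f) := by
  have hs : (1 : ℝ) ∈ Set.Icc (0 : ℝ) 1 := ⟨zero_le_one, le_rfl⟩
  rw [unitIntegral_apply, unitIntegral_apply, integral_congr_unitMeasure (L.coeFn_compLpL f) hs]
  exact L.intervalIntegral_comp_comm
    (intervalIntegrable_of_unitMeasure (L1.integrable_coeFn f) hs)

/-- The resolvents of a transport operator converge when its boundary operator is compressed to an
exhausting sequence of subspaces. -/
theorem tendsto_resolvent_of_compression {Yn : ℕ → Type*} [∀ n, NormedAddCommGroup (Yn n)]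
    [∀ n, NormedSpace ℂ (Yn n)] [∀ n, CompleteSpace (Yn n)]
    {e : ∀ n, Yn n →L[ℂ] Y} {p : ∀ n, Y →L[ℂ] Yn n} (he : ∀ n, ‖e n‖ ≤ 1) (hp : ∀ n, ‖p n‖ ≤ 1)
    (hep : ∀ v, Tendsto (fun n => e n (p n v)) atTop (𝓝 v))
    {b B : Y →L[ℂ] Y} {ν m M ω C : ℝ} {R : ℝ → Lp Y 1 unitMeasure →L[ℂ] Lp Y 1 unitMeasure}
    (H : HilleYosida (BoundaryGraph b B) R ω C)
    {an bn : ∀ n, Yn n →L[ℂ] Yn n}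
    (hTBn : ∀ n, TransportBounds (an n) (bn n) (p n ∘L B ∘L e n) ν m M)
    (hbn : ∀ n v, bn n (p n v) = p n (b v))
    {Rn : ∀ n, ℝ → Lp (Yn n) 1 unitMeasure →L[ℂ] Lp (Yn n) 1 unitMeasure}
    (Hn : ∀ n, HilleYosida (BoundaryGraph (bn n) (p n ∘L B ∘L e n)) (Rn n) ω C)
    {l : ℝ} (hl : ω < l) (h : Lp Y 1 unitMeasure) :
    Tendsto (fun n => (e n).compLpL 1 unitMeasure (Rn n l ((p n).compLpL 1 unitMeasure h))) atTop
      (𝓝 (R l h)) := by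
  set f := R l h with hf
  set g := (l : ℂ) • f - h with hg
  have hC := H.const_nonneg
  have hd : 0 < l - ω := by linarith
  have hM := (hTBn 0).M_pos
  obtain ⟨w, hw1, hw2⟩ := boundaryGraph_iff_exists.1 (H.graph_resolvent hl h)
  rw [← hf, ← hg] at hw1 hw2
  -- The cut-off of `f` starts at `p w` and ends at `p (B w)`, while the compressed boundary
  -- condition asks for `p (B (e (p w)))`; `δ` is the difference.
  set δ : ∀ n, Yn n := fun n => p n (B (w - e n (p n w))) with hδ
  have hδlim : Tendsto (fun n => ‖δ n‖) atTop (𝓝 0) := by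
    have h1 := ((hep w).const_sub w).norm.const_mul ‖B‖
    rw [sub_self, norm_zero, mul_zero] at h1
    exact squeeze_zero (fun _ => norm_nonneg _)
      (fun n => (norm_apply_le_of_norm_le_one (hp n) _).trans (B.le_opNorm _)) h1
  have hbP : ∀ n, (bn n).compLpL 1 unitMeasure ((p n).compLpL 1 unitMeasure g)
      = (p n).compLpL 1 unitMeasure (b.compLpL 1 unitMeasure g) := fun n => by
    rw [compLpL_compLpL, compLpL_compLpL]
    congr 2
    ext1 v
    exact hbn n v
  set Pf : ∀ n, Lp (Yn n) 1 unitMeasure := fun n => (p n).compLpL 1 unitMeasure f with hPf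
  -- Subtracting `x ↦ x • δ` keeps the value at `0` and removes the defect at `1`. The corrected
  -- function `y` solves the resolvent equation with data `P h + r`, and `r` is of the size of `δ`.
  set y : ∀ n, Lp (Yn n) 1 unitMeasure := fun n => Pf n - volterra (constFun (δ n)) with hy
  set r : ∀ n, Lp (Yn n) 1 unitMeasure := fun n =>
    constFun (an n (δ n)) - (l : ℂ) • volterra (constFun (δ n)) with hr
  have hbr : ∀ n, (bn n).compLpL 1 unitMeasure
      ((p n).compLpL 1 unitMeasure g - constFun (an n (δ n)))
      = (p n).compLpL 1 unitMeasure (b.compLpL 1 unitMeasure g) - constFun (δ n) := fun n => by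
    rw [map_sub, hbP, compLpL_constFun, (hTBn n).b_a]
  have hgraph : ∀ n, BoundaryGraph (bn n) (p n ∘L B ∘L e n) (y n)
      ((p n).compLpL 1 unitMeasure g - constFun (an n (δ n))) := fun n => by
    refine boundaryGraph_iff_exists.2 ⟨p n w, ?_, ?_⟩
    · rw [hbr, map_sub, ← compLpL_volterra, ← compLpL_constFun, ← add_sub_assoc, ← map_add, ← hw1]
    · rw [hbr, map_sub, unitIntegral_constFun, unitIntegral_compLpL, ← add_sub_assoc, ← map_add,
        hw2]
      simp [hδ]
  have hres : ∀ n, Rn n l ((p n).compLpL 1 unitMeasure h)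
      = Pf n - (volterra (constFun (δ n)) + Rn n l (r n)) := fun n => by
    have h1 := ((Hn n).graph_iff l hl _ _).1 (hgraph n)
    have h2 : (l : ℂ) • y n - ((p n).compLpL 1 unitMeasure g - constFun (an n (δ n)))
        = (p n).compLpL 1 unitMeasure h + r n := by
      simp only [hy, hg, hr, hPf, map_sub, map_smul, smul_sub]
      abel
    rw [h2, map_add] at h1
    rw [eq_sub_of_add_eq h1]
    simp only [hy]
    abel
  have hPflim : Tendsto (fun n => (e n).compLpL 1 unitMeasure (Pf n)) atTop (𝓝 f) := by
    have h1 := tendsto_compLpL_apply (L := fun n => e n ∘L p n) (fun n =>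
      (ContinuousLinearMap.opNorm_comp_le _ _).trans (mul_le_one₀ (he n) (norm_nonneg _) (hp n)))
      hep f
    refine h1.congr fun n => ?_
    rw [hPf, compLpL_compLpL]
  have herr : Tendsto (fun n => (e n).compLpL 1 unitMeasure
      (volterra (constFun (δ n)) + Rn n l (r n))) atTop (𝓝 0) := by
    have h1 := hδlim.const_mul (1 + C * (l - ω)⁻¹ * (M + ‖(l : ℂ)‖))
    rw [mul_zero] at h1
    refine squeeze_zero_norm (fun n => ?_) h1
    refine (norm_apply_le_of_norm_le_one
      (((e n).norm_compLpL_le (p := 1) (μ := unitMeasure)).trans (he n)) _).trans ?_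
    have hV : ‖volterra (constFun (δ n))‖ ≤ ‖δ n‖ :=
      (norm_volterra_apply_le _).trans (norm_constFun_le _)
    have hrn : ‖r n‖ ≤ (M + ‖(l : ℂ)‖) * ‖δ n‖ := by
      refine (norm_sub_le _ _).trans ?_
      rw [add_mul, norm_smul]
      gcongr
      exact (norm_constFun_le _).trans
        (((an n).le_opNorm _).trans (by gcongr; exact (hTBn n).norm_a_le))
    calc ‖volterra (constFun (δ n)) + Rn n l (r n)‖
        ≤ ‖δ n‖ + C * (l - ω)⁻¹ * ((M + ‖(l : ℂ)‖) * ‖δ n‖) := by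
          refine (norm_add_le _ _).trans (add_le_add hV (((Rn n l).le_opNorm _).trans ?_))
          gcongr
          exact (Hn n).norm_resolvent_le hl
      _ = _ := by ring
  have := hPflim.sub herr
  rw [sub_zero] at this
  refine this.congr fun n => ?_
  rw [hres]
  exact (map_sub ((e n).compLpL 1 unitMeasure) _ _).symm

end ResolventConvergence

/-! ### Direct limits of graphs and the line-graph matrix. -/

namespace SimpLocFinG

/-- The graph obtained from `G` by replacing every vertex by the copies of it indexed by `Prop`. -/
def blowUp (G : SimpLocFinG.{u}) : SimpLocFinG.{u} where
  V := G.V × Prop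
  countable_V := by
    have := G.countable_V
    infer_instance
  graph := ⟨fun p q => G.graph.Adj p.1 q.1⟩
  loopless p := G.loopless p.1
  locallyFinite p := by
    have h : {q : G.V × Prop | G.graph.Adj p.1 q.1} = {w | G.graph.Adj p.1 w} ×ˢ Set.univ := by
      ext q; simp
    exact h ▸ (G.locallyFinite p.1).prod Set.finite_univ

/-- A homomorphism to `G` together with a labelling of the vertices is a homomorphism to the
blow-up of `G`. -/
def liftBlowUp {G H : SimpLocFinG.{u}} (χ : H ⟶ G) (s : H.V → Prop) : H ⟶ G.blowUp :=
  Hom.mk (H := G.blowUp) (fun v => (onV χ v, s v)) fun v w h => Hom.map_adj χ v w h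

theorem comp_liftBlowUp {G H K : SimpLocFinG.{u}} (φ : K ⟶ H) (χ : H ⟶ G) (s : H.V → Prop) :
    φ ≫ liftBlowUp χ s = liftBlowUp (φ ≫ χ) (s ∘ onV φ) := rfl

theorem onV_comp {G H K : SimpLocFinG.{u}} (φ : K ⟶ H) (χ : H ⟶ G) (v : K.V) :
    onV (φ ≫ χ) v = onV χ (onV φ v) := rfl

theorem onEdge_comp {G H K : SimpLocFinG.{u}} (φ : K ⟶ H) (χ : H ⟶ G) (e : K.Edge) :
    onEdge (φ ≫ χ) e = onEdge χ (onEdge φ e) := rfl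

theorem onEdge_injective {G H : SimpLocFinG.{u}} {φ : G ⟶ H} (hφ : (onV φ).Injective) :
    (onEdge φ).Injective := by
  intro e e' h
  have h1 := congrArg (fun e : H.Edge => e.1) h
  simp only [onEdge, Prod.mk.injEq] at h1
  exact Subtype.ext (Prod.ext (hφ h1.1) (hφ h1.2))

section DirectLimit

variable {Gn : ℕ → SimpLocFinG.{u}} {φ : ∀ n, Gn n ⟶ Gn (n + 1)} {G : SimpLocFinG.{u}}
  {ψ : ∀ n, Gn n ⟶ G}

/-- Label a vertex by the proposition that it eventually merges with `x`. These labels are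
compatible with `φ`, so by the universal property, tested on the blow-up, the label of a vertex
depends only on its image in `G`. If `x` and `y` have the same image, they merge at a later stage
and are equal by injectivity of the `φ k`. Pairing the labels with `G` keeps the target loopless. -/
theorem onV_injective_of_isDirectLimit (hφ : ∀ n, (onV (φ n)).Injective)
    (hlim : IsDirectLimit φ ψ) (n : ℕ) : (onV (ψ n)).Injective := by
  intro x y hxy
  set s : ∀ k, (Gn k).V → Prop := fun k v => ∃ (N : ℕ) (hk : k ≤ N) (hn : n ≤ N),
    Nat.leRecOn (C := fun k => (Gn k).V) hk (fun {k} => onV (φ k)) v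
      = Nat.leRecOn (C := fun k => (Gn k).V) hn (fun {k} => onV (φ k)) x with hs
  have hcomp : ∀ k, s (k + 1) ∘ onV (φ k) = s k := by
    intro k
    funext v
    refine propext ⟨?_, ?_⟩
    · rintro ⟨N, hk, hn, h⟩
      refine ⟨N, (Nat.le_succ k).trans hk, hn, ?_⟩
      rw [← h, Nat.leRecOn_trans (Nat.le_succ k) hk, Nat.leRecOn_succ']
    · rintro ⟨N, hk, hn, h⟩
      refine ⟨N + 1, Nat.succ_le_succ hk, hn.trans (Nat.le_succ N), ?_⟩
      rw [Nat.leRecOn_succ hn, ← h, ← Nat.leRecOn_succ (C := fun k => (Gn k).V)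
        (next := fun {k} => onV (φ k)) (h2 := hk.trans (Nat.le_succ N)) hk v,
        Nat.leRecOn_trans (Nat.le_succ k) (Nat.succ_le_succ hk), Nat.leRecOn_succ']
  obtain ⟨α, hα, -⟩ := hlim.2 G.blowUp (fun k => liftBlowUp (ψ k) (s k)) fun k => by
    rw [comp_liftBlowUp, hlim.1, hcomp]
  have h1 : liftBlowUp (ψ n) (s n) = ψ n ≫ α := (hα n).symm
  have h2 : ∀ v, onV (liftBlowUp (ψ n) (s n)) v = onV α (onV (ψ n) v) := fun v => by
    rw [h1, onV_comp]
  have h3 : s n x = s n y := by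
    have := (h2 x).trans ((congrArg _ hxy).trans (h2 y).symm)
    exact congrArg Prod.snd this
  have hx : s n x := ⟨n, le_rfl, le_rfl, rfl⟩
  rw [h3] at hx
  obtain ⟨N, hk, hn, h⟩ := hx
  exact (Nat.leRecOn_injective hk _ (fun k => hφ k) h).symm

/-- The labels "true" and "lies in the image of some `ψ n`" give two homomorphisms from `G` to its
blow-up that agree after every `ψ n`; by uniqueness they coincide. -/
theorem exists_onV_eq_of_isDirectLimit (hlim : IsDirectLimit φ ψ) (v : G.V) :
    ∃ n x, onV (ψ n) x = v := by
  have hcomp : ∀ s : G.V → Prop, ∀ n, φ n ≫ ψ (n + 1) ≫ liftBlowUp (𝟙 G) s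
      = ψ n ≫ liftBlowUp (𝟙 G) s := fun s n => by
    rw [← Category.assoc, hlim.1]
  obtain ⟨α, -, hα⟩ := hlim.2 G.blowUp (fun n => ψ n ≫ liftBlowUp (𝟙 G) fun _ => True)
    (hcomp _)
  have h1 := hα (liftBlowUp (𝟙 G) fun _ => True) fun n => rfl
  have h2 := hα (liftBlowUp (𝟙 G) fun v => ∃ n x, onV (ψ n) x = v) fun n => by
    rw [comp_liftBlowUp, comp_liftBlowUp]
    congr 1
    funext x
    exact propext ⟨fun _ => trivial, fun _ => ⟨n, x, rfl⟩⟩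
  have h3 := congrArg (fun χ : G ⟶ G.blowUp => (onV χ v).2) (h1.trans h2.symm)
  exact h3.mp trivial

/-- Test the universal property on the subgraph `H` of `G` whose edges are those coming from some
`Gn n`. The induced map `G ⟶ H` is the identity on vertices, so `G` has no further edges. -/
theorem exists_adj_of_isDirectLimit (hlim : IsDirectLimit φ ψ) {v w : G.V}
    (hvw : G.graph.Adj v w) :
    ∃ n x y, (Gn n).graph.Adj x y ∧ onV (ψ n) x = v ∧ onV (ψ n) y = w := by
  let H : SimpLocFinG.{u} :=
    { V := G.V
      countable_V := G.countable_V
      graph := ⟨fun v w => ∃ n x y, (Gn n).graph.Adj x y ∧ onV (ψ n) x = v ∧ onV (ψ n) y = w⟩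
      loopless := by
        rintro v ⟨n, x, y, h, hx, hy⟩
        have := Hom.map_adj (ψ n) x y h
        refine G.loopless v ?_
        nth_rw 1 [← hx]
        rw [← hy]
        exact this
      locallyFinite := fun v => (G.locallyFinite v).subset (by
        rintro w ⟨n, x, y, h, rfl, rfl⟩
        exact Hom.map_adj (ψ n) x y h) }
  let θ : ∀ n, Gn n ⟶ H := fun n =>
    Hom.mk (H := H) (onV (H := G) (ψ n)) fun x y h => ⟨n, x, y, h, rfl, rfl⟩
  obtain ⟨α, hα, -⟩ := hlim.2 H θ fun n => by
    refine Hom.ext ?_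
    have := congrArg (fun χ : Gn n ⟶ G => onV χ) (hlim.1 n)
    exact this
  have hid : ∀ v, onV α v = v := fun v => by
    obtain ⟨n, x, rfl⟩ := exists_onV_eq_of_isDirectLimit hlim v
    exact congrArg (fun χ : Gn n ⟶ H => onV χ x) (hα n)
  have := Hom.map_adj α v w hvw
  change H.graph.Adj (onV α v) (onV α w) at this
  rw [hid, hid] at this
  exact this

theorem eventually_mem_range_onEdge (hlim : IsDirectLimit φ ψ) (e : G.Edge) :
    ∀ᶠ n in atTop, e ∈ Set.range (onEdge (ψ n)) := by
  obtain ⟨n, x, y, hxy, hx, hy⟩ := exists_adj_of_isDirectLimit hlim e.2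
  refine eventually_atTop.2 ⟨n, fun k hk => ?_⟩
  induction k, hk using Nat.le_induction with
  | base => exact ⟨⟨(x, y), hxy⟩, Subtype.ext (Prod.ext hx hy)⟩
  | succ k _ ih =>
    obtain ⟨e', rfl⟩ := ih
    exact ⟨onEdge (φ k) e', by rw [← onEdge_comp, hlim.1]⟩

end DirectLimit

/-- An injective vertex map preserves and reflects the relation "head equals tail", so the smaller
matrix is a submatrix even if `H` is not an induced subgraph. -/
theorem lineAdjC_onEdge {G H : SimpLocFinG.{u}} {ψ : H ⟶ G} (hψ : (onV ψ).Injective)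
    (c : G.Edge → ℝ) (i j : H.Edge) :
    G.lineAdjC c (onEdge ψ i) (onEdge ψ j) = H.lineAdjC (c ∘ onEdge ψ) i j := by
  have h : (onEdge ψ j).head = (onEdge ψ i).tail ↔ j.head = i.tail := hψ.eq_iff
  unfold lineAdjC lineAdj
  by_cases hij : j.head = i.tail
  · rw [if_pos hij, if_pos (h.2 hij)]; rfl
  · rw [if_neg hij, if_neg (mt h.1 hij)]; rfl

/-- The nonzero entries of column `j` sit at the edges leaving the head of `j`. These are determined
by their heads, since the graph is simple, so there are at most `N`; each entry is `c j / c i ≤ M /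
m`. -/
theorem sum_norm_lineAdjC_le {G : SimpLocFinG.{u}} {N : ℕ}
    (hN : ∀ v, {w | G.graph.Adj v w}.encard ≤ N) {c : G.Edge → ℝ} {m M : ℝ} (hm : 0 < m)
    (hM : 0 < M) (hc : ∀ j, m ≤ c j ∧ c j ≤ M) (j : G.Edge) (F : Finset G.Edge) :
    ∑ i ∈ F, ‖G.lineAdjC c i j‖ ≤ N * (M / m) := by
  classical
  have hle : ∀ i, ‖G.lineAdjC c i j‖ ≤ if j.head = i.tail then M / m else 0 := fun i => by
    unfold lineAdjC lineAdj
    split_ifs with h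
    · have hci := hc i
      have hcj := hc j
      rw [mul_one, norm_mul, norm_inv, Complex.norm_real, Complex.norm_real,
        Real.norm_of_nonneg (hm.le.trans hci.1), Real.norm_of_nonneg (hm.le.trans hcj.1),
        inv_mul_eq_div]
      exact div_le_div₀ hM.le hcj.2 hm hci.1
    · simp
  refine (Finset.sum_le_sum fun i _ => hle i).trans ?_
  rw [← Finset.sum_filter, Finset.sum_const, nsmul_eq_mul]
  refine mul_le_mul_of_nonneg_right ?_ (by positivity)
  set S := F.filter fun i => j.head = i.tail with hS
  have hinj : Set.InjOn (Edge.head (G := G)) S := by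
    intro i hi i' hi' h
    have h1 := (Finset.mem_filter.1 hi).2
    have h2 := (Finset.mem_filter.1 hi').2
    exact Subtype.ext (Prod.ext (h1.symm.trans h2) h)
  have hsub : Edge.head '' (S : Set G.Edge) ⊆ {w | G.graph.Adj j.head w} := by
    rintro _ ⟨i, hi, rfl⟩
    have h1 := (Finset.mem_filter.1 hi).2
    have h2 : G.graph.Adj i.tail i.head := i.2
    rw [← h1] at h2
    exact h2
  have hcard := (Set.encard_le_encard hsub).trans (hN j.head)
  rw [hinj.encard_image, Set.encard_coe_eq_coe_finsetCard] at hcard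
  exact_mod_cast hcard

end SimpLocFinG

/-! ### Diagonal operators, matrices and embeddings on `ℓ¹`. -/

namespace EllOne

variable {J K : Type*}

theorem hasSum_norm (v : EllOne J) : HasSum (fun j => ‖v j‖) ‖v‖ := by
  simpa using lp.hasSum_norm (p := 1) (by simp) v

theorem memℓp_of_summable {f : J → ℂ} (hf : Summable fun j => ‖f j‖) :
    Memℓp f 1 :=
  memℓp_gen (by simpa using hf)

/-- A bounded diagonal operator on `ℓ¹`. -/
theorem exists_diagonal (d : J → ℂ) {D : ℝ} (hD : 0 ≤ D) (hd : ∀ j, ‖d j‖ ≤ D) :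
    ∃ L : EllOne J →L[ℂ] EllOne J, ‖L‖ ≤ D ∧ ∀ v j, L v j = d j * v j := by
  have hle : ∀ (v : EllOne J) j, ‖d j * v j‖ ≤ D * ‖v j‖ := fun v j => by
    rw [norm_mul]; gcongr; exact hd j
  have hmem : ∀ v : EllOne J, Memℓp (fun j => d j * v j) 1 := fun v =>
    memℓp_of_summable (Summable.of_nonneg_of_le (fun _ => norm_nonneg _) (hle v)
      ((hasSum_norm v).summable.mul_left D))
  refine ⟨LinearMap.mkContinuous
    { toFun := fun v => (⟨fun j => d j * v j, hmem v⟩ : EllOne J)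
      map_add' := fun v w => lp.ext (funext fun j => mul_add _ _ _)
      map_smul' := fun c v => lp.ext (funext fun j => mul_left_comm _ _ _) } D (fun v => ?_),
    LinearMap.mkContinuous_norm_le _ hD _, fun v j => rfl⟩
  exact hasSum_le (hle v) (hasSum_norm (⟨fun j => d j * v j, hmem v⟩ : EllOne J))
    ((hasSum_norm v).mul_left D)

/-- A matrix whose columns are bounded in `ℓ¹` is a bounded operator. -/
theorem exists_matrix (A : Matrix K J ℂ) {D : ℝ} (hD : 0 ≤ D)
    (hA : ∀ (j : J) (F : Finset K), ∑ i ∈ F, ‖A i j‖ ≤ D) :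
    ∃ L : EllOne J →L[ℂ] EllOne K, ‖L‖ ≤ D ∧ ∀ v i, HasSum (fun j => A i j * v j) (L v i) := by
  have hsum : ∀ j, Summable fun i => ‖A i j‖ := fun j =>
    summable_of_sum_le (fun _ => norm_nonneg _) (hA j)
  set col : J → EllOne K := fun j => ⟨fun i => A i j, memℓp_of_summable (hsum j)⟩ with hcol
  have hcoln : ∀ j, ‖col j‖ ≤ D := fun j =>
    hasSum_le_of_sum_le (hasSum_norm (col j)) (hA j)
  have hle : ∀ (v : EllOne J) j, ‖v j • col j‖ ≤ D * ‖v j‖ := fun v j => by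
    rw [norm_smul, mul_comm]; gcongr; exact hcoln j
  have hS : ∀ v : EllOne J, Summable fun j => v j • col j := fun v =>
    Summable.of_norm_bounded ((hasSum_norm v).summable.mul_left D) (hle v)
  refine ⟨LinearMap.mkContinuous
    { toFun := fun v => ∑' j, v j • col j
      map_add' := fun v w => by
        rw [← (hS v).tsum_add (hS w)]
        exact tsum_congr fun j => add_smul _ _ _
      map_smul' := fun c v => by
        rw [RingHom.id_apply, ← (hS v).tsum_const_smul]
        exact tsum_congr fun j => mul_smul _ _ _ } D (fun v => ?_),
    LinearMap.mkContinuous_norm_le _ hD _, fun v i => ?_⟩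
  · exact (hS v).hasSum.norm_le_of_bounded ((hasSum_norm v).mul_left D) (hle v)
  · refine ((hS v).hasSum.mapL (EllOne.coord i)).congr_fun fun j => ?_
    exact mul_comm _ _

section Embedding

variable [Finite J] {ι : J → K}

theorem norm_extendZero_le (hι : ι.Injective) : ‖extendZero ι‖ ≤ 1 := by
  refine ContinuousLinearMap.opNorm_le_bound _ zero_le_one fun v => ?_
  rw [one_mul]
  refine le_of_eq ((hasSum_norm _).unique ((hι.hasSum_iff fun k hk => ?_).1 ?_))
  · rw [extendZero_apply_of_notMem v k hk, norm_zero]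
  · refine (hasSum_norm v).congr_fun fun j => ?_
    rw [Function.comp, extendZero_apply hι]

theorem norm_cutOff_le (hι : ι.Injective) :
    ‖(cutOff ι : EllOne K →L[ℂ] EllOne J)‖ ≤ 1 := by
  refine ContinuousLinearMap.opNorm_le_bound _ zero_le_one fun v => ?_
  rw [one_mul]
  refine hasSum_le_inj ι hι (fun _ _ => norm_nonneg _) (fun j => ?_) (hasSum_norm _) (hasSum_norm v)
  rw [cutOff_apply]

theorem cutOff_extendZero (hι : ι.Injective) (v : EllOne J) :
    cutOff ι (extendZero ι v) = v := by
  refine lp.ext (funext fun j => ?_)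
  rw [cutOff_apply, extendZero_apply hι]

theorem extendZero_cutOff_of_support (hι : ι.Injective) {v : EllOne K}
    (hv : ∀ k, v k ≠ 0 → k ∈ Set.range ι) : extendZero ι (cutOff ι v) = v := by
  refine lp.ext (funext fun k => ?_)
  by_cases hk : k ∈ Set.range ι
  · obtain ⟨j, rfl⟩ := hk
    rw [extendZero_apply hι, cutOff_apply]
  · rw [extendZero_apply_of_notMem _ k hk]
    by_contra h
    exact hk (hv k (Ne.symm h))

end Embedding

theorem dense_finite_support : Dense {v : EllOne K | (Function.support v).Finite} := by
  classical
  intro v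
  refine mem_closure_of_tendsto (lp.hasSum_single (p := 1) ENNReal.one_ne_top v)
    (Eventually.of_forall fun F => F.finite_toSet.subset fun k hk => ?_)
  by_contra hkF
  refine hk ?_
  rw [lp.coeFn_sum, Finset.sum_apply]
  refine Finset.sum_eq_zero fun i hi => ?_
  rw [lp.single_apply, Pi.single_eq_of_ne]
  rintro rfl
  exact hkF hi

/-- On a finitely supported vector the composition is eventually the identity; contractivity and
density give the rest. -/
theorem tendsto_extendZero_cutOff {Jn : ℕ → Type*} [∀ n, Finite (Jn n)] {ι : ∀ n, Jn n → K}
    (hι : ∀ n, (ι n).Injective) (hex : ∀ k, ∀ᶠ n in atTop, k ∈ Set.range (ι n)) (v : EllOne K) :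
    Tendsto (fun n => extendZero (ι n) (cutOff (ι n) v)) atTop (𝓝 v) := by
  refine tendsto_apply_of_dense (L := fun n => extendZero (ι n) ∘L cutOff (ι n))
    (L₀ := ContinuousLinearMap.id ℂ _) (K := 1) (Eventually.of_forall fun n => ?_)
    dense_finite_support (fun w hw => ?_) v
  · exact (ContinuousLinearMap.opNorm_comp_le _ _).trans
      (mul_le_one₀ (norm_extendZero_le (hι n)) (norm_nonneg _) (norm_cutOff_le (hι n)))
  · have h1 : ∀ᶠ n in atTop, ∀ k ∈ Function.support w, k ∈ Set.range (ι n) :=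
      (Set.Finite.eventually_all hw).2 fun k _ => hex k
    refine tendsto_const_nhds.congr' ?_
    filter_upwards [h1] with n hn
    exact (extendZero_cutOff_of_support (hι n) fun k hk => hn k hk).symm

/-- Positive diagonal operators on `ℓ¹` satisfy the bounds used for the transport operator. -/
theorem transportBounds {α : J → ℝ} {m M ν : ℝ} (hm : 0 < m) (hM : 0 < M) (hν : 0 ≤ ν)
    (hα : ∀ j, m ≤ α j ∧ α j ≤ M) {a b B : EllOne J →L[ℂ] EllOne J} (hB : ‖B‖ ≤ Real.exp ν)
    (ha : ∀ v j, a v j = (α j : ℂ) * v j) (han : ‖a‖ ≤ M)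
    (hb : ∀ v j, b v j = (α j : ℂ)⁻¹ * v j) (hbn : ‖b‖ ≤ m⁻¹) :
    TransportBounds a b B ν m M := by
  have hpos : ∀ j, 0 < α j := fun j => hm.trans_le (hα j).1
  have hne : ∀ j, (α j : ℂ) ≠ 0 := fun j => by exact_mod_cast (hpos j).ne'
  refine ⟨hm, hM, hν, fun v => lp.ext (funext fun j => ?_), fun v => lp.ext (funext fun j => ?_),
    han, hbn, hB, fun l μ ε hμ hε v => ?_⟩
  · rw [ha, hb, mul_inv_cancel_left₀ (hne j)]
  · rw [hb, ha, inv_mul_cancel_left₀ (hne j)]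
  · simp only [← Complex.coe_smul]
    refine hasSum_le (fun j => ?_) ((hasSum_norm v).add
      (((hasSum_norm (b v)).mul_left (l - μ * M)).mul_left ε)) (hasSum_norm _)
    have h1 : (v + (ε : ℂ) • ((l : ℂ) • b v - (μ : ℂ) • v) : EllOne J) j
        = ((1 + ε * (l * (α j)⁻¹ - μ) : ℝ) : ℂ) * v j := by
      simp only [lp.coeFn_add, lp.coeFn_smul, lp.coeFn_sub, Pi.add_apply, Pi.smul_apply,
        Pi.sub_apply, smul_eq_mul, hb]
      push_cast
      ring
    rw [h1, hb, norm_mul, norm_mul, norm_inv, Complex.norm_real, Complex.norm_real,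
      Real.norm_of_nonneg (hpos j).le]
    have h2 : 1 + ε * ((l - μ * M) * (α j)⁻¹) ≤ ‖1 + ε * (l * (α j)⁻¹ - μ)‖ := by
      refine le_trans ?_ (Real.le_norm_self _)
      have h3 : 1 ≤ M * (α j)⁻¹ := by
        rw [← div_eq_mul_inv, one_le_div (hpos j)]; exact (hα j).2
      -- This is `μ ≤ μ * M / α j`, which uses `α j ≤ M` and no sign of `l`.
      have h4 : (l - μ * M) * (α j)⁻¹ ≤ l * (α j)⁻¹ - μ := by nlinarith
      gcongr
    calc ‖v j‖ + ε * ((l - μ * M) * ((α j)⁻¹ * ‖v j‖))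
        = (1 + ε * ((l - μ * M) * (α j)⁻¹)) * ‖v j‖ := by ring
      _ ≤ _ := by gcongr

end EllOne

/-! ### Assembling the result for graphs. -/

/-- The transport operator on a graph as an operator with boundary condition. -/
theorem SimpLocFinG.transportGraph_iff (G : SimpLocFinG.{u}) {α c : G.Edge → ℝ}
    (hα : ∀ j, α j ≠ 0) {b B : EllOne G.Edge →L[ℂ] EllOne G.Edge}
    (hb : ∀ v j, b v j = (α j : ℂ)⁻¹ * v j)
    (hB : ∀ v i, HasSum (fun j => G.lineAdjC c i j * v j) (B v i)) (f h : PhaseSpace G.Edge) :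
    G.TransportGraph α c f h ↔ BoundaryGraph b B f h := by
  have hne : ∀ j, (α j : ℂ) ≠ 0 := fun j => by exact_mod_cast hα j
  constructor
  · rintro ⟨g, v, ⟨hfv, hv⟩, hbd, hh⟩
    have hgb : (g : ℝ → EllOne G.Edge) =ᵐ[unitMeasure] fun τ => b (h τ) := by
      filter_upwards [hh] with s hs
      refine lp.ext (funext fun j => ?_)
      rw [hb, hs, inv_mul_cancel_left₀ (hne j)]
    refine ⟨v, hfv, fun s hs => ?_, lp.ext (funext fun i => (hbd i).unique (hB (v 0) i))⟩
    rw [← integral_congr_unitMeasure hgb hs]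
    exact hv s hs
  · rintro ⟨v, hfv, hv, hbd⟩
    refine ⟨b.compLpL 1 unitMeasure h, v, ⟨hfv, fun s hs => ?_⟩, fun i => ?_, ?_⟩
    · refine (hv s hs).trans ?_
      rw [← integral_congr_unitMeasure (b.coeFn_compLpL h) hs]
      rfl
    · rw [hbd]; exact hB (v 0) i
    · filter_upwards [b.coeFn_compLpL h] with s hs j
      rw [hs, hb, mul_inv_cancel_left₀ (hne j)]

theorem mainTheorem1 (Gn : ℕ → SimpLocFinG.{u}) [∀ n, Finite (Gn n).V]
    (φ : ∀ n, Gn n ⟶ Gn (n + 1)) (hφ : ∀ n, (SimpLocFinG.onV (φ n)).Injective)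
    (G : SimpLocFinG.{u}) (ψ : ∀ n, Gn n ⟶ G) (hlim : IsDirectLimit φ ψ)
    (hG : G.UniformlyLocallyFinite)
    (a c : G.Edge → ℝ) (m M : ℝ) (hm : 0 < m)
    (ha : ∀ j, m ≤ a j ∧ a j ≤ M) (hc : ∀ j, m ≤ c j ∧ c j ≤ M) :
    (∃ T : ℝ≥0 → PhaseSpace G.Edge →L[ℂ] PhaseSpace G.Edge,
      IsSemigroupGeneratedBy T (G.TransportGraph a c)) ∧
    (∀ n, ∃ T : ℝ≥0 → PhaseSpace (Gn n).Edge →L[ℂ] PhaseSpace (Gn n).Edge,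
      IsSemigroupGeneratedBy T ((Gn n).TransportGraph
        (a ∘ SimpLocFinG.onEdge (ψ n)) (c ∘ SimpLocFinG.onEdge (ψ n)))) ∧
    ∀ (T : ℝ≥0 → PhaseSpace G.Edge →L[ℂ] PhaseSpace G.Edge)
      (Tn : ∀ n, ℝ≥0 → PhaseSpace (Gn n).Edge →L[ℂ] PhaseSpace (Gn n).Edge),
      IsSemigroupGeneratedBy T (G.TransportGraph a c) →
      (∀ n, IsSemigroupGeneratedBy (Tn n) ((Gn n).TransportGraph
        (a ∘ SimpLocFinG.onEdge (ψ n)) (c ∘ SimpLocFinG.onEdge (ψ n)))) →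
      ∀ (x : PhaseSpace G.Edge) (t₀ : ℝ≥0),
        TendstoUniformlyOn
          (fun n t => extensionOp (SimpLocFinG.onEdge (ψ n))
            (Tn n t (cutOffOp (SimpLocFinG.onEdge (ψ n)) x)))
          (fun t => T t x) atTop (Set.Icc 0 t₀) := by
  -- If there are no edges, `M` need not be positive.
  set M' : ℝ := max M m with hM'def
  have hM' : 0 < M' := hm.trans_le (le_max_right _ _)
  have ha' : ∀ j, m ≤ a j ∧ a j ≤ M' := fun j => ⟨(ha j).1, (ha j).2.trans (le_max_left _ _)⟩
  have hc' : ∀ j, m ≤ c j ∧ c j ≤ M' := fun j => ⟨(hc j).1, (hc j).2.trans (le_max_left _ _)⟩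
  have hψ : ∀ n, (SimpLocFinG.onV (ψ n)).Injective :=
    SimpLocFinG.onV_injective_of_isDirectLimit hφ hlim
  have hι : ∀ n, (SimpLocFinG.onEdge (ψ n)).Injective := fun n =>
    SimpLocFinG.onEdge_injective (hψ n)
  obtain ⟨N, hN⟩ := hG
  obtain ⟨B, hBn, hB⟩ := EllOne.exists_matrix (G.lineAdjC c) (D := N * (M' / m)) (by positivity)
    (SimpLocFinG.sum_norm_lineAdjC_le hN hm hM' hc')
  -- The maximum with `1` ensures `ν ≥ 0`, while `exp ν` still dominates `‖B‖` and all its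
  -- compressions.
  set ν : ℝ := Real.log (max (N * (M' / m)) 1) with hν
  have hν0 : 0 ≤ ν := Real.log_nonneg (le_max_right _ _)
  have hexp : Real.exp ν = max (N * (M' / m)) 1 :=
    Real.exp_log (zero_lt_one.trans_le (le_max_right _ _))
  have hBν : ‖B‖ ≤ Real.exp ν := hexp ▸ hBn.trans (le_max_left _ _)
  have hdiag : ∀ {J : Type u} (α : J → ℝ), (∀ j, m ≤ α j ∧ α j ≤ M') →
      (∃ L : EllOne J →L[ℂ] EllOne J, ‖L‖ ≤ M' ∧ ∀ v j, L v j = (α j : ℂ) * v j) ∧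
      ∃ L : EllOne J →L[ℂ] EllOne J, ‖L‖ ≤ m⁻¹ ∧ ∀ v j, L v j = (α j : ℂ)⁻¹ * v j :=
    fun α hα => by
      refine ⟨EllOne.exists_diagonal _ hM'.le fun j => ?_,
        EllOne.exists_diagonal _ (inv_nonneg.2 hm.le) fun j => ?_⟩
      · rw [Complex.norm_real, Real.norm_of_nonneg (hm.le.trans (hα j).1)]
        exact (hα j).2
      · rw [norm_inv, Complex.norm_real, Real.norm_of_nonneg (hm.le.trans (hα j).1)]
        exact inv_anti₀ hm (hα j).1
  obtain ⟨⟨va, van, hva⟩, ⟨vb, vbn, hvb⟩⟩ := hdiag a ha'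
  have hTB : TransportBounds va vb B ν m M' :=
    EllOne.transportBounds hm hM' hν0 ha' hBν hva van hvb vbn
  have han : ∀ n j, m ≤ (a ∘ SimpLocFinG.onEdge (ψ n)) j ∧ (a ∘ SimpLocFinG.onEdge (ψ n)) j ≤ M' :=
    fun n j => ha' _
  choose van' vann hvan using fun n => (hdiag _ (han n)).1
  choose vbn' vbnn hvbn using fun n => (hdiag _ (han n)).2
  set e := fun n => EllOne.extendZero (SimpLocFinG.onEdge (ψ n)) with he
  set p : ∀ n, EllOne G.Edge →L[ℂ] EllOne (Gn n).Edge := fun n =>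
    EllOne.cutOff (SimpLocFinG.onEdge (ψ n)) with hp
  have hen : ∀ n, ‖e n‖ ≤ 1 := fun n => EllOne.norm_extendZero_le (hι n)
  have hpn : ∀ n, ‖p n‖ ≤ 1 := fun n => EllOne.norm_cutOff_le (hι n)
  have hpe : ∀ n v, p n (e n v) = v := fun n => EllOne.cutOff_extendZero (hι n)
  have hep : ∀ v, Tendsto (fun n => e n (p n v)) atTop (𝓝 v) :=
    EllOne.tendsto_extendZero_cutOff hι (SimpLocFinG.eventually_mem_range_onEdge hlim)
  have hBnν : ∀ n, ‖p n ∘L B ∘L e n‖ ≤ Real.exp ν := fun n => by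
    refine ContinuousLinearMap.opNorm_le_bound _ (Real.exp_pos _).le fun v => ?_
    refine (norm_apply_le_of_norm_le_one (hpn n) _).trans ((B.le_opNorm _).trans ?_)
    gcongr
    exact norm_apply_le_of_norm_le_one (hen n) v
  -- The boundary operator of `Gn n` is the compression of `B`: zero extension discards the columns
  -- outside the image, and cut-off keeps the rows inside it.
  have hBn' : ∀ n v i, HasSum (fun j => (Gn n).lineAdjC (c ∘ SimpLocFinG.onEdge (ψ n)) i j * v j)
      ((p n ∘L B ∘L e n) v i) := fun n v i => by
    have h1 := hB (e n v) (SimpLocFinG.onEdge (ψ n) i)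
    rw [← (hι n).hasSum_iff fun k hk => by
      rw [he, EllOne.extendZero_apply_of_notMem v k hk, mul_zero]] at h1
    have h2 : (p n ∘L B ∘L e n) v i = B (e n v) (SimpLocFinG.onEdge (ψ n) i) :=
      EllOne.cutOff_apply _ _
    rw [h2]
    refine h1.congr_fun fun j => ?_
    rw [Function.comp, he, EllOne.extendZero_apply (hι n), SimpLocFinG.lineAdjC_onEdge (hψ n)]
  -- The constants do not depend on `n`; this is the stability required by Trotter–Kato.
  have hTBn : ∀ n, TransportBounds (van' n) (vbn' n) (p n ∘L B ∘L e n) ν m M' := fun n =>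
    EllOne.transportBounds hm hM' hν0 (han n) (hBnν n) (hvan n) (vann n) (hvbn n) (vbnn n)
  have hgraph : G.TransportGraph a c = BoundaryGraph vb B := by
    funext f h
    exact propext (G.transportGraph_iff (fun j => (hm.trans_le (ha j).1).ne') hvb hB f h)
  have hgraphn : ∀ n, (Gn n).TransportGraph (a ∘ SimpLocFinG.onEdge (ψ n))
      (c ∘ SimpLocFinG.onEdge (ψ n)) = BoundaryGraph (vbn' n) (p n ∘L B ∘L e n) := fun n => by
    funext f h
    exact propext ((Gn n).transportGraph_iff (fun j => (hm.trans_le (han n j).1).ne') (hvbn n)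
      (hBn' n) f h)
  obtain ⟨R, H⟩ := hTB.exists_hilleYosida
  choose Rn Hn using fun n => (hTBn n).exists_hilleYosida
  rw [hgraph]
  simp only [hgraphn]
  refine ⟨H.exists_isSemigroupGeneratedBy, fun n => (Hn n).exists_isSemigroupGeneratedBy,
    fun T Tn hT hTn x t₀ => ?_⟩
  refine tendstoUniformlyOn_of_resolvent H Hn
    (E := fun n => extensionOp (SimpLocFinG.onEdge (ψ n)))
    (P := fun n => cutOffOp (SimpLocFinG.onEdge (ψ n)))
    (fun n => (ContinuousLinearMap.norm_compLpL_le _).trans (hen n))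
    (fun n => (ContinuousLinearMap.norm_compLpL_le _).trans (hpn n))
    (fun n y => ?_) (fun y => ?_) (fun l hl y => ?_) hT hTn x t₀
  · have h1 : p n ∘L e n = ContinuousLinearMap.id ℂ _ := ContinuousLinearMap.ext (hpe n)
    have h2 := compLpL_compLpL (p n) (e n) y
    rw [h1, compLpL_id] at h2
    exact h2
  · have h1 := tendsto_compLpL_apply (L := fun n => e n ∘L p n) (fun n =>
      (ContinuousLinearMap.opNorm_comp_le _ _).trans (mul_le_one₀ (hen n) (norm_nonneg _) (hpn n)))
      hep y
    exact h1.congr fun n => (compLpL_compLpL (e n) (p n) y).symm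
  · refine tendsto_resolvent_of_compression hen hpn hep H hTBn (fun n v => ?_) Hn hl y
    refine lp.ext (funext fun j => ?_)
    rw [hvbn, hp, EllOne.cutOff_apply, EllOne.cutOff_apply, hvb]
    rfl
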